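/- **Proposition (no balanced metric on $M_+$ for $m=2,4$).** Let $P_0,\dots,P_m$ be a symmetric Clifford system on $\mathbb{R}^{2l}$, i.e. symmetric matrices with $P_iP_j+P_jP_i=2\delta_{ij}I_{2l}$, with $l-m-1>0$. Put $F(x)=|x|^4-2\sum_{i=0}^m\langle P_ix,x\rangle^2$, $f=F|_{S^{2l-1}(1)}$, and let $$M_+=f^{-1}(1)=\{x\in S^{2l-1}(1) : \langle P_0x,x\rangle=\dots=\langle P_mx,x\rangle=0\}$$ be the focal submanifold of OT-FKM type; its tangent space $T_xM_+$ is the orthogonal complement of $\mathrm{Span}\{x,P_0x,\dots,P_mx\}$ in $\mathbb{R}^{2l}$. For an almost complex structure $J$ on $M_+$, a Hermitian metric is a smooth Riemannian metric $g$ on $M_+$ with $g(JX,JY)=g(X,Y)$; its Kähler form is $\omega(X,Y)=g(JX,Y)$, and $g$ is called balanced if $d(\omega^{n-1})=0$, where $n=\frac12\dim_{\mathbb{R}}M_+=\frac12(2l-m-2)$. (i) Let $m=2$ and let $J$ be the complex structure on $M_+$ given at $x\in M_+$ by $$JP_0P_1x=P_0P_1P_2x,\quad JP_0P_1P_2x=-P_0P_1x,\quad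 JX=P_0P_1X\ \text{ for } X\in T_xM_+,\ X\perp P_0P_1x,\,P_0P_1P_2x.$$ Then $(M_+,J)$ admits no balanced Hermitian metric. (ii) Let $m=4$ in the definite case, i.e. $P_0P_1P_2P_3P_4=\pm I_{2l}$, and let $J$ be the complex structure on $M_+$ given at $x\in M_+$ by $$JP_0P_1x=P_3P_4x,\quad JP_3P_4x=-P_0P_1x,\quad JP_2P_3x=P_2P_4x,\quad JP_2P_4x=-P_2P_3x,$$ and $JX=P_0P_1X$ for $X\in T_xM_+$ orthogonal to $P_0P_1x,P_3P_4x,P_2P_3x,P_2P_4x$. Then $(M_+,J)$ admits no balanced Hermitian metric. -/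

import Mathlib

open scoped InnerProductSpace ContDiff

set_option linter.unusedSimpArgs false

namespace OTFKM

/-- The Euclidean space `ℝ^{2l}`. -/
abbrev E (l : ℕ) : Type := EuclideanSpace ℝ (Fin (2 * l))

/-- A symmetric Clifford system `P_0, …, P_m` on `ℝ^{2l}`: symmetric operators with
`P_i P_j + P_j P_i = 2 δ_{ij} Id`. -/
structure CliffordSystem (m l : ℕ) where
  op : Fin (m + 1) → E l →L[ℝ] E l
  symmetric : ∀ i, IsSelfAdjoint (op i)
  clifford : ∀ i j, op i * op j + op j * op i = if i = j then (2 : ℝ) • 1 else 0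

namespace CliffordSystem

variable {m l : ℕ} (P : CliffordSystem m l)

/-- The homogeneous polynomial `F(x) = |x|⁴ - 2 ∑ ⟨P_i x, x⟩²`. -/
noncomputable def F (x : E l) : ℝ := ‖x‖ ^ 4 - 2 * ∑ i, ⟪P.op i x, x⟫_ℝ ^ 2

/-- The focal submanifold `M_+ = f⁻¹(1)`, where `f` is the restriction of `F` to the unit sphere. -/
def MPlus : Set (E l) := {x | ‖x‖ = 1 ∧ P.F x = 1}

/-- The tangent space of `M_+` at `x ∈ M_+`: the orthogonal complement in `ℝ^{2l}` of the normal
space, which is spanned by `x, P_0 x, …, P_m x`. -/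
noncomputable def tangent (x : E l) : Submodule ℝ (E l) :=
  (Submodule.span ℝ (insert x (Set.range fun i => P.op i x)))ᗮ

/-- Half the dimension of `M_+`, i.e. its complex dimension when `M_+` is a complex manifold
(`dim M_+ = 2l - (m + 2)`, see `finrank_tangent`). -/
def complexDim (_P : CliffordSystem m l) : ℕ := (2 * l - (m + 2)) / 2

/-! ### Elementary facts -/

theorem op_inner (i : Fin (m + 1)) (x y : E l) : ⟪P.op i x, y⟫_ℝ = ⟪x, P.op i y⟫_ℝ :=
  ContinuousLinearMap.isSelfAdjoint_iff_isSymmetric.1 (P.symmetric i) x y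

theorem op_sq (i : Fin (m + 1)) (x : E l) : P.op i (P.op i x) = x := by
  have h := congrArg (fun T : E l →L[ℝ] E l => T x) (P.clifford i i)
  rw [if_pos rfl, ← two_smul ℝ] at h
  exact smul_right_injective _ (two_ne_zero : (2 : ℝ) ≠ 0) h

theorem norm_op (i : Fin (m + 1)) (x : E l) : ‖P.op i x‖ = ‖x‖ := by
  rw [← sq_eq_sq₀ (norm_nonneg _) (norm_nonneg _), ← real_inner_self_eq_norm_sq, P.op_inner,
    P.op_sq, real_inner_self_eq_norm_sq]

theorem op_anti {i j : Fin (m + 1)} (hij : j < i) (x : E l) :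
    P.op i (P.op j x) = -P.op j (P.op i x) := by
  have h := congrArg (fun T : E l →L[ℝ] E l => T x) (P.clifford i j)
  rw [if_neg hij.ne'] at h
  exact eq_neg_of_add_eq_zero_left h

theorem mem_MPlus_iff {x : E l} :
    x ∈ P.MPlus ↔ ‖x‖ = 1 ∧ ∀ i, ⟪x, P.op i x⟫_ℝ = 0 := by
  simp only [MPlus, F, Set.mem_ofPred_eq]
  refine and_congr_right fun hx => ?_
  have h1 : (‖x‖ ^ 4 - 2 * ∑ i, ⟪P.op i x, x⟫_ℝ ^ 2 = 1) ↔ ∑ i, ⟪P.op i x, x⟫_ℝ ^ 2 = 0 := by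
    rw [hx]; constructor <;> intro h <;> linarith
  rw [h1, Finset.sum_eq_zero_iff_of_nonneg fun i _ => sq_nonneg _]
  simp [P.op_inner]

theorem mem_tangent_iff {x v : E l} :
    v ∈ P.tangent x ↔ ⟪v, x⟫_ℝ = 0 ∧ ∀ i, ⟪v, P.op i x⟫_ℝ = 0 := by
  rw [tangent, Submodule.mem_orthogonal']
  constructor
  · intro h
    exact ⟨h _ (Submodule.subset_span (by simp)),
      fun i => h _ (Submodule.subset_span (by simp))⟩
  · rintro ⟨h1, h2⟩ u hu
    induction hu using Submodule.span_induction with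
    | mem y hy =>
      rcases hy with rfl | ⟨i, rfl⟩
      · exact h1
      · exact h2 i
    | zero => simp
    | add y z _ _ hy hz => rw [inner_add_right, hy, hz, add_zero]
    | smul a y _ hy => rw [inner_smul_right, hy, mul_zero]

theorem inner_op_op {i j : Fin (m + 1)} (hij : i ≠ j) (x : E l) :
    ⟪x, P.op i (P.op j x)⟫_ℝ = 0 := by
  have key : ∀ {i j : Fin (m + 1)}, j < i → ⟪x, P.op i (P.op j x)⟫_ℝ = 0 := by
    intro i j h
    have h1 : ⟪x, P.op i (P.op j x)⟫_ℝ = ⟪x, P.op j (P.op i x)⟫_ℝ := by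
      rw [← P.op_inner, ← P.op_inner, ← P.op_inner, ← P.op_inner, real_inner_comm, P.op_inner,
        P.op_inner, ← P.op_inner]
    rw [P.op_anti h, inner_neg_right] at h1 ⊢
    linarith
  rcases lt_or_gt_of_ne hij with h | h
  · have h2 := key h
    rw [P.op_anti h, inner_neg_right] at h2
    linarith
  · exact key h

/-- `x, P_0 x, …, P_m x` are orthonormal for `x ∈ M_+`, hence `dim M_+ = 2l - (m + 2)`. -/
theorem finrank_tangent {x : E l} (hx : x ∈ P.MPlus) :
    Module.finrank ℝ (P.tangent x) = 2 * l - (m + 2) := by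
  obtain ⟨h1, h2⟩ := P.mem_MPlus_iff.1 hx
  let b : Option (Fin (m + 1)) → E l := fun o => o.elim x fun i => P.op i x
  have hb : Orthonormal ℝ b := by
    rw [orthonormal_iff_ite]
    rintro (_ | i) (_ | j)
    · simp [b, h1]
    · simp [b, h2]
    · simp [b, P.op_inner, h2]
    · by_cases hij : i = j
      · subst hij; simp [b, P.norm_op, h1]
      · simp [b, P.op_inner, P.inner_op_op hij, hij]
  have hr : Set.range b = insert x (Set.range fun i => P.op i x) := by
    ext y; simp [b, Option.exists, eq_comm]
  have hs := finrank_span_eq_card hb.linearIndependent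
  rw [hr] at hs
  have ht := Submodule.finrank_add_finrank_orthogonal
    (Submodule.span ℝ (insert x (Set.range fun i => P.op i x)))
  rw [hs] at ht
  simp only [Fintype.card_option, Fintype.card_fin, finrank_euclideanSpace] at ht
  rw [tangent]
  omega

/-! ### Almost complex structures, Hermitian metrics and differential forms on `M_+`

Smooth tensor fields on the embedded submanifold `M_+` are the restrictions to the tangent spaces
of `M_+` of smooth tensor fields on an open neighbourhood of `M_+`. -/

/-- A smooth almost complex structure on `M_+`: a smooth field of endomorphisms of the tangent
spaces with square `-1`. -/
structure AlmostComplexStructure where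
  J : ∀ x : P.MPlus, P.tangent x →ₗ[ℝ] P.tangent x
  J_sq : ∀ x v, J x (J x v) = -v
  smooth : ∃ (U : Set (E l)) (K : E l → E l →L[ℝ] E l), IsOpen U ∧ P.MPlus ⊆ U ∧
    ContDiffOn ℝ ∞ K U ∧ ∀ (x : P.MPlus) (v : P.tangent x), K x v = J x v

/-- A smooth Hermitian metric on `(M_+, J)`: a Riemannian metric for which `J` is an isometry. -/
structure HermitianMetric {P : CliffordSystem m l} (J : P.AlmostComplexStructure) where
  g : ∀ x : P.MPlus, P.tangent x →ₗ[ℝ] P.tangent x →ₗ[ℝ] ℝ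
  symm : ∀ x v w, g x v w = g x w v
  pos : ∀ x v, v ≠ 0 → 0 < g x v v
  hermitian : ∀ x v w, g x (J.J x v) (J.J x w) = g x v w
  smooth : ∃ (U : Set (E l)) (G : E l → E l →L[ℝ] E l →L[ℝ] ℝ), IsOpen U ∧ P.MPlus ⊆ U ∧
    ContDiffOn ℝ ∞ G U ∧ ∀ (x : P.MPlus) (v w : P.tangent x), G x v w = g x v w

/-- A field of alternating `p`-forms on the tangent spaces of `M_+`. -/
abbrev Form (P : CliffordSystem m l) (p : ℕ) : Type :=
  ∀ x : P.MPlus, P.tangent x [⋀^Fin p]→ₗ[ℝ] ℝ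

/-- `β`, defined on an open neighbourhood of `M_+` in `ℝ^{2l}`, restricts to the form `α`
on `M_+`. -/
def RestrictsTo {P : CliffordSystem m l} {p : ℕ} (β : E l → E l [⋀^Fin p]→L[ℝ] ℝ)
    (α : P.Form p) : Prop :=
  ∀ (x : P.MPlus) (v : Fin p → P.tangent x), β x (fun i => (v i : E l)) = α x v

/-- `dα = γ` on `M_+`: the form `α` is the restriction of a smooth form `β` on an open
neighbourhood of `M_+`, and `γ` is the restriction of the exterior derivative of `β`
(exterior derivatives commute with restriction, so the choice of `β` is immaterial). -/
def HasExtDeriv {P : CliffordSystem m l} {p : ℕ} (α : P.Form p) (γ : P.Form (p + 1)) : Prop :=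
  ∃ (U : Set (E l)) (β : E l → E l [⋀^Fin p]→L[ℝ] ℝ), IsOpen U ∧ P.MPlus ⊆ U ∧
    ContDiffOn ℝ ∞ β U ∧ RestrictsTo β α ∧ RestrictsTo (extDeriv β) γ

end CliffordSystem

section Wedge

variable {V : Type*} [AddCommGroup V] [Module ℝ V]

/-- The wedge product of real-valued alternating forms (sum over shuffles). -/
noncomputable def wedge {p q : ℕ} (a : V [⋀^Fin p]→ₗ[ℝ] ℝ) (b : V [⋀^Fin q]→ₗ[ℝ] ℝ) :
    V [⋀^Fin (p + q)]→ₗ[ℝ] ℝ :=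
  ((LinearMap.mul' ℝ ℝ).compAlternatingMap (a.domCoprod b)).domDomCongr finSumFinEquiv

/-- The `k`-th wedge power of a two-form. -/
noncomputable def wedgePow (η : V [⋀^Fin 2]→ₗ[ℝ] ℝ) : ∀ k : ℕ, V [⋀^Fin (2 * k)]→ₗ[ℝ] ℝ
  | 0 => (AlternatingMap.constOfIsEmpty ℝ V (Fin 0) (1 : ℝ) : V [⋀^Fin 0]→ₗ[ℝ] ℝ)
  | k + 1 => wedge (wedgePow η k) η

end Wedge

namespace CliffordSystem.HermitianMetric

variable {m l : ℕ} {P : CliffordSystem m l} {J : P.AlmostComplexStructure}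

/-- The Kähler form `ω(X, Y) = g(JX, Y)`. -/
noncomputable def kahlerForm (h : HermitianMetric J) : P.Form 2 := fun x =>
  { toFun := fun v => h.g x (J.J x (v 0)) (v 1)
    map_update_add' := by
      intro _ v i a b
      fin_cases i <;> simp [Function.update]
    map_update_smul' := by
      intro _ v i c a
      fin_cases i <;> simp [Function.update]
    map_eq_zero_of_eq' := by
      intro v i j hv hij
      have h01 : v 0 = v 1 := by
        fin_cases i <;> fin_cases j <;> simp_all
      have h1 := h.hermitian x (J.J x (v 1)) (v 1)
      rw [J.J_sq, map_neg, LinearMap.neg_apply, h.symm] at h1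
      rw [h01]
      linarith }

/-- A Hermitian metric is balanced if `d(ω^{n-1}) = 0`, where `n` is the complex dimension. -/
def IsBalanced (h : HermitianMetric J) : Prop :=
  HasExtDeriv (P := P) (fun x => wedgePow (h.kahlerForm x) (P.complexDim - 1)) (fun _ => 0)

end CliffordSystem.HermitianMetric

/-! ### The complex structures for `m = 2` and `m = 4` -/

section BlockJ

variable {V : Type*} [NormedAddCommGroup V] [InnerProductSpace ℝ V] {r : ℕ}

/-- The operator with `e_i ↦ f_i`, `f_i ↦ -e_i` (for orthonormal `e_1, …, e_r, f_1, …, f_r`) and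
`X ↦ A X` for `X` orthogonal to all `e_i, f_i`. -/
noncomputable def blockJ (A : V →L[ℝ] V) (e f : Fin r → V) : V →L[ℝ] V :=
  A ∘L (1 - ∑ i, ((innerSL ℝ (e i)).smulRight (e i) + (innerSL ℝ (f i)).smulRight (f i)))
    + ∑ i, ((innerSL ℝ (e i)).smulRight (f i) - (innerSL ℝ (f i)).smulRight (e i))

theorem blockJ_apply (A : V →L[ℝ] V) (e f : Fin r → V) (X : V) :
    blockJ A e f X = A (X - ∑ i, (⟪e i, X⟫_ℝ • e i + ⟪f i, X⟫_ℝ • f i))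
      + ∑ i, (⟪e i, X⟫_ℝ • f i - ⟪f i, X⟫_ℝ • e i) := by
  simp [blockJ, innerSL_apply_apply]

theorem contDiff_blockJ {A : V →L[ℝ] V} {e f : V → Fin r → V}
    (he : ∀ i, ContDiff ℝ ∞ fun x => e x i) (hf : ∀ i, ContDiff ℝ ∞ fun x => f x i) :
    ContDiff ℝ ∞ fun x => blockJ A (e x) (f x) := by
  have h : ∀ {a b : V → V}, ContDiff ℝ ∞ a → ContDiff ℝ ∞ b →
      ContDiff ℝ ∞ fun x => (innerSL ℝ (a x)).smulRight (b x) := fun ha hb =>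
    ((innerSL ℝ (E := V)).contDiff.comp ha).smulRight hb
  unfold blockJ
  refine ContDiff.add (contDiff_const.clm_comp (contDiff_const.sub ?_)) ?_
  · exact ContDiff.sum fun i _ => (h (he i) (he i)).add (h (hf i) (hf i))
  · exact ContDiff.sum fun i _ => (h (he i) (hf i)).sub (h (hf i) (he i))

variable {A : V →L[ℝ] V} {e f : Fin r → V} {T : Submodule ℝ V}

theorem blockJ_of_orthogonal {X : V} (h1 : ∀ i, ⟪X, e i⟫_ℝ = 0) (h2 : ∀ i, ⟪X, f i⟫_ℝ = 0) :
    blockJ A e f X = A X := by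
  have h1' := fun i => (real_inner_comm X (e i)).trans (h1 i)
  have h2' := fun i => (real_inner_comm X (f i)).trans (h2 i)
  simp [blockJ_apply, h1', h2']

/-- The conditions under which `blockJ A e f` is a complex structure on the subspace `T`. -/
structure IsBlock (A : V →L[ℝ] V) (e f : Fin r → V) (T : Submodule ℝ V) : Prop where
  ee : ∀ i j, ⟪e i, e j⟫_ℝ = if i = j then 1 else 0
  ff : ∀ i j, ⟪f i, f j⟫_ℝ = if i = j then 1 else 0
  ef : ∀ i j, ⟪e i, f j⟫_ℝ = 0
  e_mem : ∀ i, e i ∈ T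
  f_mem : ∀ i, f i ∈ T
  A_sq : ∀ X, A (A X) = -X
  A_maps : ∀ X ∈ T, (∀ i, ⟪X, e i⟫_ℝ = 0) → (∀ i, ⟪X, f i⟫_ℝ = 0) →
    A X ∈ T ∧ (∀ i, ⟪A X, e i⟫_ℝ = 0) ∧ ∀ i, ⟪A X, f i⟫_ℝ = 0

theorem IsBlock.fe (h : IsBlock A e f T) (i j : Fin r) : ⟪f i, e j⟫_ℝ = 0 := by
  rw [real_inner_comm, h.ef]

theorem IsBlock.blockJ_e (h : IsBlock A e f T) (i : Fin r) : blockJ A e f (e i) = f i := by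
  simp [blockJ_apply, h.ee, h.fe]

theorem IsBlock.blockJ_f (h : IsBlock A e f T) (i : Fin r) : blockJ A e f (f i) = -e i := by
  simp [blockJ_apply, h.ff, h.ef]

theorem IsBlock.exists_decomp (h : IsBlock A e f T) {X : V} (hX : X ∈ T) :
    ∃ (Y : V) (a b : Fin r → ℝ), Y ∈ T ∧ (∀ i, ⟪Y, e i⟫_ℝ = 0) ∧ (∀ i, ⟪Y, f i⟫_ℝ = 0) ∧
      X = Y + ∑ i, (a i • e i + b i • f i) := by
  refine ⟨X - ∑ i, (⟪e i, X⟫_ℝ • e i + ⟪f i, X⟫_ℝ • f i), fun i => ⟪e i, X⟫_ℝ,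
    fun i => ⟪f i, X⟫_ℝ, ?_, ?_, ?_, by simp⟩
  · exact T.sub_mem hX (T.sum_mem fun i _ =>
      T.add_mem (T.smul_mem _ (h.e_mem i)) (T.smul_mem _ (h.f_mem i)))
  · intro i
    simp [inner_sub_left, sum_inner, inner_add_left, inner_smul_left, h.ee, h.fe,
      real_inner_comm (e i) X]
  · intro i
    simp [inner_sub_left, sum_inner, inner_add_left, inner_smul_left, h.ff, h.ef,
      real_inner_comm (f i) X]

theorem IsBlock.blockJ_mem_and_sq (h : IsBlock A e f T) {X : V} (hX : X ∈ T) :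
    blockJ A e f X ∈ T ∧ blockJ A e f (blockJ A e f X) = -X := by
  obtain ⟨Y, a, b, hY, h1, h2, rfl⟩ := h.exists_decomp hX
  obtain ⟨h3, h4, h5⟩ := h.A_maps Y hY h1 h2
  have hJ : blockJ A e f (Y + ∑ i, (a i • e i + b i • f i))
      = A Y + ∑ i, (a i • f i - b i • e i) := by
    simp [blockJ_of_orthogonal h1 h2, h.blockJ_e, h.blockJ_f, sub_eq_add_neg]
  rw [hJ]
  refine ⟨T.add_mem h3 (T.sum_mem fun i _ =>
    T.sub_mem (T.smul_mem _ (h.f_mem i)) (T.smul_mem _ (h.e_mem i))), ?_⟩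
  simp only [map_add, map_sum, map_sub, map_smul, blockJ_of_orthogonal h4 h5, h.blockJ_e,
    h.blockJ_f, h.A_sq, neg_add, ← Finset.sum_neg_distrib]
  congr 1
  exact Finset.sum_congr rfl fun i _ => by rw [smul_neg]; abel

end BlockJ

namespace CliffordSystem

variable {m l : ℕ}

/-- The almost complex structure on `M_+` given at `x` by `blockJ A (e x) (f x)`. -/
noncomputable def ofBlock (P : CliffordSystem m l) {r : ℕ} (A : E l →L[ℝ] E l)
    (e f : E l → Fin r → E l)
    (he : ∀ i, ContDiff ℝ ∞ fun x => e x i) (hf : ∀ i, ContDiff ℝ ∞ fun x => f x i)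
    (h : ∀ x ∈ P.MPlus, IsBlock A (e x) (f x) (P.tangent x)) : P.AlmostComplexStructure where
  J x := (blockJ A (e x) (f x)).toLinearMap.restrict fun _ hv =>
    ((h x x.2).blockJ_mem_and_sq hv).1
  J_sq x v := Subtype.ext ((h x x.2).blockJ_mem_and_sq v.2).2
  smooth := ⟨Set.univ, fun x => blockJ A (e x) (f x), isOpen_univ, Set.subset_univ _,
    (contDiff_blockJ he hf).contDiffOn, fun _ _ => rfl⟩

/-- For `x ∈ M_+`, the space `T_x M_+ = Span{P₀P₁x} ⊕ Span{P₀P₁P₂x} ⊕ E` with `P₀P₁ E = E`. -/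
theorem isBlock_two (P : CliffordSystem 2 l) {x : E l} (hx : x ∈ P.MPlus) :
    IsBlock (P.op 0 * P.op 1) ![P.op 0 (P.op 1 x)] ![P.op 0 (P.op 1 (P.op 2 x))]
      (P.tangent x) := by
  obtain ⟨h1, h2⟩ := P.mem_MPlus_iff.1 hx
  have a10 : ∀ y, P.op 1 (P.op 0 y) = -P.op 0 (P.op 1 y) := P.op_anti (by decide)
  have a20 : ∀ y, P.op 2 (P.op 0 y) = -P.op 0 (P.op 2 y) := P.op_anti (by decide)
  have a21 : ∀ y, P.op 2 (P.op 1 y) = -P.op 1 (P.op 2 y) := P.op_anti (by decide)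
  have b01 : ⟪x, P.op 0 (P.op 1 x)⟫_ℝ = 0 := P.inner_op_op (by decide) x
  have b02 : ⟪x, P.op 0 (P.op 2 x)⟫_ℝ = 0 := P.inner_op_op (by decide) x
  have b12 : ⟪x, P.op 1 (P.op 2 x)⟫_ℝ = 0 := P.inner_op_op (by decide) x
  have c012 : ⟪x, P.op 0 (P.op 1 (P.op 2 x))⟫_ℝ = 0 := by
    have := real_inner_comm x (P.op 0 (P.op 1 (P.op 2 x)))
    simp only [P.op_inner, a10, a20, a21, map_neg, inner_neg_right, neg_neg] at this
    linarith
  refine ⟨?_, ?_, ?_, ?_, ?_, ?_, ?_⟩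
  · simp [P.norm_op, h1]
  · simp [P.norm_op, h1]
  · simp [P.op_inner, P.op_sq, h2]
  · simp [Fin.forall_fin_one, mem_tangent_iff, Fin.forall_fin_succ, P.op_inner, P.op_sq, h2, a10,
      a20, a21, b01, b02, b12, c012]
  · simp [Fin.forall_fin_one, mem_tangent_iff, Fin.forall_fin_succ, P.op_inner, P.op_sq, h2, a10,
      a20, a21, b01, b02, b12, c012]
  · simp [P.op_sq, a10]
  · simp only [mem_tangent_iff, Fin.forall_fin_one, Fin.forall_fin_succ]
    simp [P.op_inner, P.op_sq, a10, a20, a21]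
    intros
    simp [*]

/-- The almost complex structure on `M_+` for `m = 2`:
`J P₀P₁x = P₀P₁P₂x`, `J P₀P₁P₂x = -P₀P₁x`, and `J X = P₀P₁X` for `X ∈ T_x M_+` orthogonal to
`P₀P₁x` and `P₀P₁P₂x`. -/
noncomputable def J2 (P : CliffordSystem 2 l) : P.AlmostComplexStructure :=
  P.ofBlock (P.op 0 * P.op 1) (fun x => ![P.op 0 (P.op 1 x)])
    (fun x => ![P.op 0 (P.op 1 (P.op 2 x))])
    (by simp only [Fin.forall_fin_one, Matrix.cons_val_zero]; fun_prop)
    (by simp only [Fin.forall_fin_one, Matrix.cons_val_zero]; fun_prop)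
    (fun _ hx => P.isBlock_two hx)

/-- A Clifford system with `m = 4` is definite if `P₀P₁P₂P₃P₄ = ± Id`. -/
def IsDefinite (P : CliffordSystem 4 l) : Prop :=
  P.op 0 * P.op 1 * P.op 2 * P.op 3 * P.op 4 = 1 ∨
    P.op 0 * P.op 1 * P.op 2 * P.op 3 * P.op 4 = -1

/-- In the definite case, for `x ∈ M_+`,
`T_x M_+ = Span{P₀P₁x, P₂P₃x, P₂P₄x, P₃P₄x} ⊕ V` with `P₀P₁ V = V`. -/
theorem isBlock_four (P : CliffordSystem 4 l) (hP : P.IsDefinite) {x : E l} (hx : x ∈ P.MPlus) :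
    IsBlock (P.op 0 * P.op 1) ![P.op 0 (P.op 1 x), P.op 2 (P.op 3 x)]
      ![P.op 3 (P.op 4 x), P.op 2 (P.op 4 x)] (P.tangent x) := by
  obtain ⟨h1, h2⟩ := P.mem_MPlus_iff.1 hx
  obtain ⟨ε, hε⟩ : ∃ ε : ℝ, ∀ y, P.op 0 (P.op 1 (P.op 2 (P.op 3 (P.op 4 y)))) = ε • y := by
    rcases hP with h | h
    · exact ⟨1, fun y => by simpa using congrArg (fun T : E l →L[ℝ] E l => T y) h⟩
    · exact ⟨-1, fun y => by simpa using congrArg (fun T : E l →L[ℝ] E l => T y) h⟩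
  have a : ∀ i j : Fin 5, j < i → ∀ y, P.op i (P.op j y) = -P.op j (P.op i y) :=
    fun i j h => P.op_anti h
  have b : ∀ i j : Fin 5, i ≠ j → ⟪x, P.op i (P.op j x)⟫_ℝ = 0 := fun i j h => P.inner_op_op h x
  have a10 := a 1 0 (by decide)
  have a20 := a 2 0 (by decide)
  have a21 := a 2 1 (by decide)
  have a30 := a 3 0 (by decide)
  have a31 := a 3 1 (by decide)
  have a32 := a 3 2 (by decide)
  have a40 := a 4 0 (by decide)
  have a41 := a 4 1 (by decide)
  have a42 := a 4 2 (by decide)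
  have a43 := a 4 3 (by decide)
  have d0 : ∀ y, P.op 0 (P.op 1 y) = -(ε • P.op 2 (P.op 3 (P.op 4 y))) := by
    intro y
    have := hε (P.op 4 (P.op 3 (P.op 2 y)))
    simp only [P.op_sq] at this
    rw [this]
    simp [a32, a42, a43]
  have c : ∀ i j k : Fin 5, i < j → j < k → ⟪x, P.op i (P.op j (P.op k x))⟫_ℝ = 0 := by
    intro i j k hij hjk
    have := real_inner_comm x (P.op i (P.op j (P.op k x)))
    simp only [P.op_inner, a j i hij, a k i (hij.trans hjk), a k j hjk, map_neg, inner_neg_right,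
      neg_neg] at this
    linarith
  have hd : ∀ i j : Fin 5, 2 ≤ i → i < j →
      ⟪P.op 0 (P.op 1 x), P.op i (P.op j x)⟫_ℝ = 0 := by
    intro i j hi hij
    rw [d0, inner_neg_left, inner_smul_left]
    fin_cases i <;> fin_cases j <;> simp at hi hij <;>
      simp [P.op_inner, P.op_sq, h2, a32, a42, a43]
  refine ⟨?_, ?_, ?_, ?_, ?_, ?_, ?_⟩
  · simp [Fin.forall_fin_succ, P.norm_op, h1, hd,
      real_inner_comm (P.op 0 (P.op 1 x)) (P.op 2 (P.op 3 x))]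
  · simp [Fin.forall_fin_succ, P.norm_op, h1, P.op_inner, P.op_sq, a32, a42, a43, b]
  · simp [Fin.forall_fin_succ, hd, P.op_inner, P.op_sq, a32, a42, a43, b]
  · simp [Fin.forall_fin_succ, mem_tangent_iff, P.op_inner, P.op_sq, h2, a10, a20, a21, a30, a31,
      a32, a40, a41, a42, a43, b, c]
  · simp [Fin.forall_fin_succ, mem_tangent_iff, P.op_inner, P.op_sq, h2, a10, a20, a21, a30, a31,
      a32, a40, a41, a42, a43, b, c]
  · simp [P.op_sq, a10]
  · simp only [mem_tangent_iff, Fin.forall_fin_succ]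
    simp [P.op_inner, P.op_sq, a10, a20, a21, a30, a31, a32, a40, a41, a42, a43]
    intro X _ _ _ _ _ _ h _ _ _
    rw [d0, inner_neg_right, inner_smul_right, neg_eq_zero, mul_eq_zero] at h
    simp [*, P.op_sq, inner_smul_right]

/-- The almost complex structure on `M_+` for `m = 4` in the definite case:
`J P₀P₁x = P₃P₄x`, `J P₃P₄x = -P₀P₁x`, `J P₂P₃x = P₂P₄x`, `J P₂P₄x = -P₂P₃x`, and
`J X = P₀P₁X` for `X ∈ T_x M_+` orthogonal to these four vectors. -/
noncomputable def J3 (P : CliffordSystem 4 l) (hP : P.IsDefinite) : P.AlmostComplexStructure :=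
  P.ofBlock (P.op 0 * P.op 1) (fun x => ![P.op 0 (P.op 1 x), P.op 2 (P.op 3 x)])
    (fun x => ![P.op 3 (P.op 4 x), P.op 2 (P.op 4 x)])
    (by simp only [Fin.forall_fin_two, Matrix.cons_val_zero, Matrix.cons_val_one]
        constructor <;> fun_prop)
    (by simp only [Fin.forall_fin_two, Matrix.cons_val_zero, Matrix.cons_val_one]
        constructor <;> fun_prop)
    (fun _ hx => P.isBlock_four hP hx)

end CliffordSystem

end OTFKM

/-! The obstruction is a one-form whose differential is semipositive. Let `A = P₀P₁`, which is skew
with `A² = -1`, and let `θ = ⟨Ax, dx⟩`, so that `dθ(u, v) = 2⟨Au, v⟩`. The vectors `e_i`, `f_i` on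
which `J` differs from `A` are sent by `A` to normal vectors of `M_+`, and on their orthogonal
complement in the tangent space `J = A`. Hence `dθ(X, JX) = 2|AY|² ≥ 0`, where `Y` is the component
of `X` orthogonal to all `e_i`, `f_i`. The hypothesis on `l` makes this complement nonzero at every
point.

If `ω^{n-1}` were closed, then `d(θ ∧ ω^{n-1}) = dθ ∧ ω^{n-1}`. Evaluated on a unitary-type frame
`(w_0, Jw_0, w_1, Jw_1, …)`, this is a sum of terms `dθ(w_i, Jw_i)` with positive weights, hence
nowhere zero. An exact form of top degree on the nonempty compact `M_+` cannot be nowhere zero. The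
linear algebra is in `IsPairFrame.wedgePow_pos`, `IsPairFrame.wedgePow_removeNth_eq_zero` and
`extDeriv_wedgeOne_innerSL_apply`.

Integration over `M_+` is replaced by integration over the ambient space. With `F_i` the defining
functions of `M_+` and `γ` an extension of `θ ∧ ω^{n-1}`, the form `μ = dF_{m+1} ∧ … ∧ dF_0 ∧ γ` has
codegree one. It is killed by `dG` for `G = ∑ F_i²`, so a cutoff depending on `G` alone contributes
nothing to the derivative. Euclidean Stokes then forces `dμ` to vanish at a point of `M_+`
(`exists_extDeriv_eq_zero`), whereas evaluation on normal vectors followed by the frame shows `dμ ≠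
0` there. These parts meet in `not_isBalanced_of_semipositive`. -/

namespace OTFKM

/-! ### Exterior multiplication by one-forms and its exterior derivative -/

section ExteriorCalculus

open ContinuousAlternatingMap Filter Topology

variable {V : Type*} [NormedAddCommGroup V] [NormedSpace ℝ V] {p : ℕ}

/-- The wedge product `a ∧ b` of a one-form `a` and an alternating form `b`. -/
noncomputable def wedgeOne (a : V →L[ℝ] ℝ) (b : V [⋀^Fin p]→L[ℝ] ℝ) : V [⋀^Fin (p + 1)]→L[ℝ] ℝ :=
  alternatizeUncurryFin (a.smulRight b)

theorem wedgeOne_apply (a : V →L[ℝ] ℝ) (b : V [⋀^Fin p]→L[ℝ] ℝ) (v : Fin (p + 1) → V) :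
    wedgeOne a b v = ∑ i : Fin (p + 1), (-1) ^ (i : ℕ) * (a (v i) * b (i.removeNth v)) := by
  simp [wedgeOne, alternatizeUncurryFin_apply]

theorem wedgeOne_eq_zero_of_forall {a : V →L[ℝ] ℝ} {b : V [⋀^Fin p]→L[ℝ] ℝ} {v : Fin (p + 1) → V}
    (h : ∀ i : Fin (p + 1), b (i.removeNth v) = 0) : wedgeOne a b v = 0 := by
  simp [wedgeOne_apply, h]

theorem wedgeOne_cons {a : V →L[ℝ] ℝ} {b : V [⋀^Fin p]→L[ℝ] ℝ} {v : V} {u : Fin p → V}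
    (h : ∀ i, a (u i) = 0) :
    wedgeOne a b (Fin.cons v u : Fin (p + 1) → V) = a v * b u := by
  simp [wedgeOne_apply, Fin.sum_univ_succ, h, Fin.removeNth_zero]

theorem wedgeOne_smul_left (c : ℝ) (a : V →L[ℝ] ℝ) (b : V [⋀^Fin p]→L[ℝ] ℝ) :
    wedgeOne (c • a) b = c • wedgeOne a b := by
  ext v; simp only [wedgeOne_apply, ContinuousAlternatingMap.smul_apply, Finset.smul_sum]
  exact Finset.sum_congr rfl fun i _ => by simp; ring

theorem wedgeOne_sum_left {ι : Type*} (s : Finset ι) (a : ι → V →L[ℝ] ℝ)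
    (b : V [⋀^Fin p]→L[ℝ] ℝ) :
    wedgeOne (∑ i ∈ s, a i) b = ∑ i ∈ s, wedgeOne (a i) b := by
  ext v
  simp only [wedgeOne_apply, ContinuousAlternatingMap.sum_apply, _root_.sum_apply,
    Finset.sum_mul, Finset.mul_sum]
  exact Finset.sum_comm

theorem wedgeOne_add_right (a : V →L[ℝ] ℝ) (b b' : V [⋀^Fin p]→L[ℝ] ℝ) :
    wedgeOne a (b + b') = wedgeOne a b + wedgeOne a b' := by
  ext v; simp [wedgeOne_apply, mul_add, Finset.sum_add_distrib]

theorem wedgeOne_smul_right (c : ℝ) (a : V →L[ℝ] ℝ) (b : V [⋀^Fin p]→L[ℝ] ℝ) :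
    wedgeOne a (c • b) = c • wedgeOne a b := by
  ext v; simp only [wedgeOne_apply, ContinuousAlternatingMap.smul_apply, Finset.smul_sum]
  exact Finset.sum_congr rfl fun i _ => by simp; ring

theorem wedgeOne_zero_right (a : V →L[ℝ] ℝ) : wedgeOne a (0 : V [⋀^Fin p]→L[ℝ] ℝ) = 0 := by
  ext v; simp [wedgeOne_apply]

/-- Puts the iterated wedge into the double-alternatization form behind `d² = 0`. The resulting sum
over pairs `i ≤ j` is antisymmetric in `a` and `b`, which gives both `wedgeOne_self` and
`wedgeOne_anticomm`. -/
theorem wedgeOne_wedgeOne (a b : V →L[ℝ] ℝ) (β : V [⋀^Fin p]→L[ℝ] ℝ) :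
    wedgeOne a (wedgeOne b β) =
      alternatizeUncurryFin (alternatizeUncurryFinCLM ℝ V ℝ ∘L a.smulRight (b.smulRight β)) := by
  rw [wedgeOne]
  congr 1
  ext x
  simp [wedgeOne]

theorem wedgeOne_wedgeOne_apply (a b : V →L[ℝ] ℝ) (β : V [⋀^Fin p]→L[ℝ] ℝ)
    (v : Fin (p + 2) → V) :
    wedgeOne a (wedgeOne b β) v = ∑ i : Fin (p + 1), ∑ j ≥ i, (-1) ^ (i + j : ℕ) *
      ((a (v i.castSucc) * b (v j.succ) - a (v j.succ) * b (v i.castSucc)) *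
        β (j.removeNth (i.castSucc.removeNth v))) := by
  rw [wedgeOne_wedgeOne, alternatizeUncurryFin_alternatizeUncurryFinCLM_comp_apply]
  simp [sub_mul, mul_assoc]

theorem wedgeOne_self (a : V →L[ℝ] ℝ) (β : V [⋀^Fin p]→L[ℝ] ℝ) :
    wedgeOne a (wedgeOne a β) = 0 := by
  ext v; simp [wedgeOne_wedgeOne_apply, mul_comm]

theorem wedgeOne_anticomm (a b : V →L[ℝ] ℝ) (β : V [⋀^Fin p]→L[ℝ] ℝ) :
    wedgeOne a (wedgeOne b β) = -wedgeOne b (wedgeOne a β) := by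
  ext v
  simp only [wedgeOne_wedgeOne_apply, ContinuousAlternatingMap.neg_apply, ← Finset.sum_neg_distrib]
  exact Finset.sum_congr rfl fun i _ => Finset.sum_congr rfl fun j _ => by ring

theorem contDiffAt_alternatizeUncurryFin {n : WithTop ℕ∞} {f : V → V →L[ℝ] V [⋀^Fin p]→L[ℝ] ℝ}
    {x : V} (hf : ContDiffAt ℝ n f x) :
    ContDiffAt ℝ n (fun y => alternatizeUncurryFin (f y)) x := by
  have h : ContDiff ℝ n (alternatizeUncurryFinCLM ℝ V ℝ (n := p)) :=
    ContinuousLinearMap.contDiff _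
  exact h.contDiffAt.comp x hf

theorem contDiffAt_wedgeOne {n : WithTop ℕ∞} {a : V → V →L[ℝ] ℝ} {β : V → V [⋀^Fin p]→L[ℝ] ℝ}
    {x : V} (ha : ContDiffAt ℝ n a x) (hβ : ContDiffAt ℝ n β x) :
    ContDiffAt ℝ n (fun y => wedgeOne (a y) (β y)) x :=
  contDiffAt_alternatizeUncurryFin (ContDiffAt.smulRight ha hβ)

theorem contDiffAt_extDeriv {β : V → V [⋀^Fin p]→L[ℝ] ℝ} {x : V}
    (hβ : ContDiffAt ℝ ∞ β x) : ContDiffAt ℝ ∞ (extDeriv β) x :=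
  contDiffAt_alternatizeUncurryFin (hβ.fderiv_right (m := ∞) (by simp))

theorem eventually_contDiffAt_one {W : Type*} [NormedAddCommGroup W] [NormedSpace ℝ W] {F : V → W}
    {x : V} (hF : ContDiffAt ℝ ∞ F x) : ∀ᶠ y in 𝓝 x, ContDiffAt ℝ 1 F y :=
  (hF.of_le (m := 1) (by exact_mod_cast le_top)).eventually (by simp)

theorem extDeriv_smul_of_differentiableAt {F : V → ℝ} {β : V → V [⋀^Fin p]→L[ℝ] ℝ} {x : V}
    (hF : DifferentiableAt ℝ F x) (hβ : DifferentiableAt ℝ β x) :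
    extDeriv (fun y => F y • β y) x = wedgeOne (fderiv ℝ F x) (β x) + F x • extDeriv β x := by
  simp only [extDeriv, fderiv_fun_smul hF hβ, alternatizeUncurryFin_add,
    alternatizeUncurryFin_smul, wedgeOne]
  exact add_comm _ _

/-- Near `x` one has `dF ∧ β = d(Fβ) - F dβ`. Applying `d` and using `d² = 0` twice leaves `-d(F dβ)
= -dF ∧ dβ`, so only the Leibniz rule for functions is needed. -/
theorem extDeriv_wedgeOne_fderiv {F : V → ℝ} {β : V → V [⋀^Fin p]→L[ℝ] ℝ} {x : V}
    (hF : ContDiffAt ℝ ∞ F x) (hβ : ContDiffAt ℝ ∞ β x) :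
    extDeriv (fun y => wedgeOne (fderiv ℝ F y) (β y)) x =
      -wedgeOne (fderiv ℝ F x) (extDeriv β x) := by
  have h1 : (fun y => wedgeOne (fderiv ℝ F y) (β y)) =ᶠ[𝓝 x]
      fun y => extDeriv (fun z => F z • β z) y + (-1 : ℝ) • (F y • extDeriv β y) := by
    filter_upwards [eventually_contDiffAt_one hF, eventually_contDiffAt_one hβ] with y h1 h2
    rw [extDeriv_smul_of_differentiableAt (h1.differentiableAt one_ne_zero)
      (h2.differentiableAt one_ne_zero)]
    simp
  have h2 : ContDiffAt ℝ ∞ (fun z => F z • β z) x := hF.smul hβ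
  have h3 : ContDiffAt ℝ ∞ (fun z => F z • extDeriv β z) x := hF.smul (contDiffAt_extDeriv hβ)
  have hmin : minSmoothness ℝ 2 ≤ ∞ := by
    simp only [minSmoothness_of_isRCLikeNormedField]; exact WithTop.coe_le_coe.2 le_top
  rw [h1.extDeriv_eq, extDeriv_fun_add (ω₂ := fun y => (-1 : ℝ) • (F y • extDeriv β y))
    ((contDiffAt_extDeriv h2).differentiableAt (by simp))
    ((h3.differentiableAt (by simp)).const_smul (-1 : ℝ)), extDeriv_extDeriv_apply h2 hmin]
  have h5 : extDeriv (fun y => (-1 : ℝ) • (F y • extDeriv β y)) x =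
      (-1 : ℝ) • extDeriv (fun z => F z • extDeriv β z) x :=
    extDeriv_fun_smul (x := x) (-1 : ℝ) (fun z => F z • extDeriv β z)
  rw [h5, extDeriv_smul_of_differentiableAt (hF.differentiableAt (by simp))
    ((contDiffAt_extDeriv hβ).differentiableAt (by simp)), extDeriv_extDeriv_apply hβ hmin]
  simp

/-- The form `dF_{q-1} ∧ … ∧ dF_0 ∧ γ`. -/
noncomputable def wedgeFDeriv (F : ℕ → V → ℝ) (γ : V → V [⋀^Fin p]→L[ℝ] ℝ) :
    ∀ (q : ℕ), V → V [⋀^Fin (p + q)]→L[ℝ] ℝ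
  | 0 => γ
  | q + 1 => fun x => wedgeOne (fderiv ℝ (F q) x) (wedgeFDeriv F γ q x)

variable {F : ℕ → V → ℝ} {γ : V → V [⋀^Fin p]→L[ℝ] ℝ} {x : V}

theorem contDiffAt_wedgeFDeriv (hF : ∀ i, ContDiffAt ℝ ∞ (F i) x) (hγ : ContDiffAt ℝ ∞ γ x)
    (q : ℕ) :
    ContDiffAt ℝ ∞ (wedgeFDeriv F γ q) x := by
  induction q with
  | zero => exact hγ
  | succ q ih => exact contDiffAt_wedgeOne ((hF q).fderiv_right (m := ∞) (by simp)) ih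

theorem wedgeOne_wedgeFDeriv_of_lt {q i : ℕ} (hi : i < q) :
    wedgeOne (fderiv ℝ (F i) x) (wedgeFDeriv F γ q x) = 0 := by
  induction q with
  | zero => omega
  | succ q ih =>
    rw [wedgeFDeriv]
    rcases Nat.lt_succ_iff_lt_or_eq.1 hi with h | rfl
    · rw [wedgeOne_anticomm, ih h, wedgeOne_zero_right, neg_zero]
    · exact wedgeOne_self _ _

/-- The tuple `(n_{q-1}, …, n_0, t_0, …, t_{p-1})`. -/
def consTuple {V : Type*} {p : ℕ} (n : ℕ → V) (t : Fin p → V) : ∀ q : ℕ, Fin (p + q) → V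
  | 0 => t
  | q + 1 => (Fin.cons (n q) (consTuple n t q) : Fin (p + q + 1) → V)

theorem forall_consTuple {V : Type*} {p : ℕ} {n : ℕ → V} {t : Fin p → V} {Q : V → Prop} {q : ℕ}
    (hn : ∀ i < q, Q (n i)) (ht : ∀ i, Q (t i)) (i : Fin (p + q)) : Q (consTuple n t q i) := by
  induction q with
  | zero => exact ht i
  | succ q ih =>
    refine Fin.cases ?_ (fun i => ?_) i
    · exact hn q (by omega)
    · exact ih (fun j hj => hn j (by omega)) i

/-- Up to sign the derivative is `dF_{q-1} ∧ … ∧ dF_0 ∧ dγ`. By triangularity each `dF_i` vanishes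
on every vector after `n_i` in the tuple, so the value is `±∏ dF_i(n_i) · dγ(t)`. -/
theorem extDeriv_wedgeFDeriv_consTuple_ne_zero {n : ℕ → V} {t : Fin (p + 1) → V} {q : ℕ}
    (hF : ∀ i, ContDiffAt ℝ ∞ (F i) x) (hγ : ContDiffAt ℝ ∞ γ x)
    (hn : ∀ i < q, ∀ j < i, fderiv ℝ (F i) x (n j) = 0)
    (hn' : ∀ i < q, fderiv ℝ (F i) x (n i) ≠ 0)
    (ht : ∀ i < q, ∀ j, fderiv ℝ (F i) x (t j) = 0) (h : extDeriv γ x t ≠ 0) :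
    extDeriv (wedgeFDeriv F γ q) x ≠ 0 := by
  -- The degrees `p + q + 1` and `p + 1 + q` agree only propositionally; the induction therefore
  -- carries the value `s` along with an arbitrary cast.
  suffices h : ∃ (s : ℝ), s ≠ 0 ∧ ∀ e : p + q + 1 = p + 1 + q,
      extDeriv (wedgeFDeriv F γ q) x (consTuple n t q ∘ Fin.cast e) = s by
    obtain ⟨s, hs, h⟩ := h
    intro h0
    apply hs
    rw [← h (by omega), h0]; rfl
  induction q with
  | zero => exact ⟨_, h, fun e => rfl⟩
  | succ q ih =>
    obtain ⟨s, hs, h'⟩ := ih (fun i hi => hn i (by omega)) (fun i hi => hn' i (by omega))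
      (fun i hi => ht i (by omega))
    refine ⟨-(fderiv ℝ (F q) x (n q) * s), neg_ne_zero.2 (mul_ne_zero (hn' q (by omega)) hs),
      fun e => ?_⟩
    have e' : p + q + 1 = p + 1 + q := by omega
    have h1 : consTuple n t (q + 1) ∘ Fin.cast e =
        (Fin.cons (n q) (consTuple n t q ∘ Fin.cast e') : Fin (p + q + 1 + 1) → V) := by
      funext i
      refine Fin.cases rfl (fun i => rfl) i
    rw [h1]
    have h2 := extDeriv_wedgeOne_fderiv (hF q) (contDiffAt_wedgeFDeriv hF hγ q)
    change extDeriv (fun y => wedgeOne (fderiv ℝ (F q) y) (wedgeFDeriv F γ q y)) x _ = _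
    rw [h2, ContinuousAlternatingMap.neg_apply, wedgeOne_cons, h']
    intro i
    exact forall_consTuple (Q := fun v => fderiv ℝ (F q) x v = 0) (hn q (by omega))
      (ht q (by omega)) _

end ExteriorCalculus

/-! ### Stokes' theorem in the ambient space and localization at a compact zero set -/

section Stokes

open MeasureTheory Filter Topology

variable {V : Type*} [NormedAddCommGroup V] [NormedSpace ℝ V] [FiniteDimensional ℝ V]
  [MeasurableSpace V] [BorelSpace V] {p : ℕ}

/-- The integral of a directional derivative of a compactly supported function vanishes. -/
theorem integral_fderiv_apply_eq_zero {ν : Measure V} [ν.IsAddHaarMeasure] {f : V → ℝ}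
    (hf : ContDiff ℝ 1 f) (hc : HasCompactSupport f) (v : V) : ∫ x, fderiv ℝ f x v ∂ν = 0 := by
  have h1 : Integrable (fun x => fderiv ℝ f x v) ν :=
    ((hf.continuous_fderiv one_ne_zero).clm_apply continuous_const).integrable_of_hasCompactSupport
      (hc.fderiv_apply ℝ v)
  have h2 : Integrable f ν := hf.continuous.integrable_of_hasCompactSupport hc
  -- Integration by parts against the constant function 1.
  have h := integral_mul_fderiv_eq_neg_fderiv_mul_of_integrable (μ := ν) (f := fun _ => (1 : ℝ))
    (g := f) (v := v) (by simp) (by simpa using h1) (by simpa using h2)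
    (fun x _ => differentiableAt_const _) (fun x _ => hf.differentiable one_ne_zero x)
  simpa using h

/-- **Stokes' theorem** for compactly supported forms of codegree one. -/
theorem integral_extDeriv_apply_eq_zero {ν : Measure V} [ν.IsAddHaarMeasure]
    {μ : V → V [⋀^Fin p]→L[ℝ] ℝ} (hμ : ContDiff ℝ 1 μ) (hc : HasCompactSupport μ)
    (v : Fin (p + 1) → V) : ∫ x, extDeriv μ x v ∂ν = 0 := by
  have hs : ∀ u : Fin p → V, ContDiff ℝ 1 (fun x => μ x u) := fun u =>
    (ContinuousAlternatingMap.apply ℝ V ℝ u).contDiff.comp hμ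
  have hk : ∀ u : Fin p → V, HasCompactSupport (fun x => μ x u) := fun u =>
    hc.comp_left (g := fun w : V [⋀^Fin p]→L[ℝ] ℝ => w u) rfl
  simp only [fun x => extDeriv_apply (hμ.differentiable one_ne_zero x) v]
  rw [integral_finsetSum]
  · refine Finset.sum_eq_zero fun i _ => ?_
    simp only [zsmul_eq_mul, integral_const_mul, integral_fderiv_apply_eq_zero (hs _) (hk _),
      mul_zero]
  · intro i _
    simp only [zsmul_eq_mul]
    exact ((((hs _).continuous_fderiv one_ne_zero).clm_apply
      continuous_const).integrable_of_hasCompactSupport ((hk _).fderiv_apply ℝ _)).const_mul _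

/-- If a form `μ` of codegree one near a compact zero set of `G ≥ 0` satisfies `dG ∧ μ = 0`, then
`dμ` has a zero on this zero set. -/
theorem exists_extDeriv_eq_zero {G : V → ℝ} {U : Set V} {μ : V → V [⋀^Fin p]→L[ℝ] ℝ}
    (hp : p + 1 = Module.finrank ℝ V) (hG : ContDiff ℝ ∞ G) (hG0 : ∀ x, 0 ≤ G x)
    (hGc : IsCompact {x | G x ≤ 1}) (hne : ∃ x, G x = 0) (hU : IsOpen U)
    (hGU : ∀ x, G x = 0 → x ∈ U) (hμ : ∀ x ∈ U, ContDiffAt ℝ ∞ μ x)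
    (hGμ : ∀ x ∈ U, wedgeOne (fderiv ℝ G x) (μ x) = 0) :
    ∃ x, G x = 0 ∧ extDeriv μ x = 0 := by
  by_contra! hcon
  -- A form of top degree vanishes exactly when its value on a basis does, so `dμ` is encoded by the
  -- scalar function `h`.
  let b : Module.Basis (Fin (p + 1)) ℝ V := Module.finBasisOfFinrankEq ℝ V hp.symm
  let h : V → ℝ := fun x => extDeriv μ x b
  have hne0 : ∀ x, G x = 0 → h x ≠ 0 := by
    intro x hx h0
    apply hcon x hx
    apply ContinuousAlternatingMap.toAlternatingMap_injective
    exact (AlternatingMap.map_basis_eq_zero_iff b (extDeriv μ x).toAlternatingMap).1 h0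
  have hcont : ContinuousOn h U := fun x hx =>
    (((ContinuousAlternatingMap.apply ℝ V ℝ (b : Fin (p + 1) → V)).continuous.continuousAt).comp
      (contDiffAt_extDeriv (hμ x hx)).continuousAt).continuousWithinAt
  obtain ⟨U', hU', hU'eq⟩ : ∃ U', IsOpen U' ∧ U' = U ∩ {x | h x ≠ 0} :=
    ⟨_, hcont.isOpen_inter_preimage hU isOpen_ne, rfl⟩
  -- `G` is positive on the compact set of points with `G ≤ 1` outside `U'`, so it has a positive
  -- minimum there; half of it serves as `ε`.
  obtain ⟨ε, hε, hε1, hεU⟩ : ∃ ε > 0, ε ≤ 1 ∧ ∀ x, G x ≤ ε → x ∈ U' := by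
    have hK : IsCompact ({x | G x ≤ 1} \ U') := hGc.diff hU'
    rcases ({x | G x ≤ 1} \ U').eq_empty_or_nonempty with he | hn
    · refine ⟨1, one_pos, le_rfl, fun x hx => ?_⟩
      by_contra hxU
      exact (he ▸ (⟨hx, hxU⟩ : x ∈ {x | G x ≤ 1} \ U') : x ∈ (∅ : Set V))
    · obtain ⟨y, hy, hmin⟩ := hK.exists_isMinOn hn hG.continuous.continuousOn
      have hGy : 0 < G y := by
        refine lt_of_le_of_ne (hG0 y) fun h0 => hy.2 ?_
        rw [hU'eq]
        exact ⟨hGU y h0.symm, hne0 y h0.symm⟩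
      refine ⟨min 1 (G y / 2), by positivity, min_le_left _ _, fun x hx => ?_⟩
      by_contra hxU
      have h1 : G y ≤ G x := hmin ⟨hx.trans (min_le_left _ _), hxU⟩
      linarith [hx.trans (min_le_right _ _)]
  let χ : V → ℝ := fun x => Real.smoothTransition (1 - 2 * G x / ε)
  have hχ : ContDiff ℝ ∞ χ := Real.smoothTransition.contDiff.comp (by fun_prop)
  have hχ0 : ∀ x, ε / 2 ≤ G x → χ x = 0 := by
    intro x hx
    apply Real.smoothTransition.zero_of_nonpos
    rw [sub_nonpos, le_div_iff₀ hε]; linarith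
  have hχ1 : ∀ x, G x = 0 → χ x = 1 := by
    intro x hx
    simp [χ, hx]
  -- Since `χ` is a function of `G`, `dχ` is a multiple of `dG`, and therefore `dχ ∧ μ = 0` on `U`.
  have hχd : ∀ x, ∃ c : ℝ, fderiv ℝ χ x = c • fderiv ℝ G x := by
    intro x
    have hs : HasDerivAt Real.smoothTransition (deriv Real.smoothTransition (1 - 2 * G x / ε))
        (1 - 2 * G x / ε) :=
      (Real.smoothTransition.contDiff (n := 1)).differentiable one_ne_zero _ |>.hasDerivAt
    have hg : HasFDerivAt (fun y => 1 - 2 * G y / ε) ((-(2 / ε)) • fderiv ℝ G x) x := by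
      have := (((hG.differentiable (by simp) x).hasFDerivAt.const_smul (-(2 / ε))).const_add 1)
      refine this.congr_of_eventuallyEq (Eventually.of_forall fun y => ?_)
      simp; ring
    have := (hs.comp_hasFDerivAt x hg).fderiv
    exact ⟨_, this.trans (smul_smul _ _ _)⟩
  -- `h` has no zero on `U'`, so its sign is locally constant there. Multiplying by it turns `h`
  -- into `|h|`, without connectedness or a choice of orientation.
  let s : V → ℝ := fun x => SignType.sign (h x)
  let ν : V → V [⋀^Fin p]→L[ℝ] ℝ := fun x => (s x * χ x) • μ x
  have hνU : ∀ x ∈ U', ContDiffAt ℝ ∞ ν x ∧ extDeriv ν x b = |h x| * χ x := by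
    intro x hx
    have hx' := hx
    rw [hU'eq] at hx'
    have hse : s =ᶠ[𝓝 x] fun _ => s x := by
      have hc : ContinuousAt h x := hcont.continuousAt (hU.mem_nhds hx'.1)
      rcases lt_or_gt_of_ne hx'.2 with h1 | h1
      · filter_upwards [hc.eventually_lt_const h1] with y hy
        simp [s, sign_neg h1, sign_neg hy]
      · filter_upwards [hc.eventually_const_lt h1] with y hy
        simp [s, sign_pos h1, sign_pos hy]
    have hνe : ν =ᶠ[𝓝 x] fun y => (s x * χ y) • μ y := by
      filter_upwards [hse] with y hy
      simp only [ν, hy]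
    have hd : ContDiffAt ℝ ∞ (fun y => s x * χ y) x := contDiffAt_const.mul hχ.contDiffAt
    refine ⟨(hd.smul (hμ x hx'.1)).congr_of_eventuallyEq hνe, ?_⟩
    obtain ⟨c, hc⟩ := hχd x
    rw [hνe.extDeriv_eq, extDeriv_smul_of_differentiableAt (hd.differentiableAt (by simp))
      ((hμ x hx'.1).differentiableAt (by simp)), fderiv_const_mul (hχ.differentiable (by simp) x),
      hc, smul_smul, wedgeOne_smul_left, hGμ x hx'.1, smul_zero, zero_add]
    change s x * χ x * h x = _
    rw [← sign_mul_self (h x)]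
    ring
  have hν0 : ∀ x, ε / 2 < G x → ν =ᶠ[𝓝 x] fun _ => 0 := by
    intro x hx
    filter_upwards [hG.continuous.continuousAt.eventually_const_lt hx] with y hy
    simp [ν, hχ0 y hy.le]
  have hνd : ∀ x, ε / 2 < G x → extDeriv ν x b = 0 := by
    intro x hx
    rw [(hν0 x hx).extDeriv_eq]
    simp [extDeriv, ContinuousAlternatingMap.alternatizeUncurryFin_apply]
  have hUG : ∀ x, x ∉ U' → ε / 2 < G x := by
    intro x hx
    by_contra! h1
    exact hx (hεU x (by linarith))
  have hνs : ContDiff ℝ ∞ ν := by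
    rw [contDiff_iff_contDiffAt]
    intro x
    by_cases hx : x ∈ U'
    · exact (hνU x hx).1
    · exact contDiffAt_const.congr_of_eventuallyEq (hν0 x (hUG x hx))
  have hνc : HasCompactSupport ν := by
    refine HasCompactSupport.intro hGc fun x hx => ?_
    rw [Set.mem_ofPred_eq, not_le] at hx
    exact (hν0 x (by linarith)).self_of_nhds
  have hnn : ∀ x, 0 ≤ extDeriv ν x b := by
    intro x
    by_cases hx : x ∈ U'
    · rw [(hνU x hx).2]
      exact mul_nonneg (abs_nonneg _) (Real.smoothTransition.nonneg _)
    · exact (hνd x (hUG x hx)).ge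
  obtain ⟨x₀, hx₀⟩ := hne
  have hpos : extDeriv ν x₀ b ≠ 0 := by
    rw [(hνU x₀ (hεU x₀ (by linarith))).2, hχ1 x₀ hx₀, mul_one]
    exact abs_ne_zero.2 (hne0 x₀ hx₀)
  have hνc' : HasCompactSupport fun x => extDeriv ν x b := by
    refine HasCompactSupport.intro hGc fun x hx => ?_
    rw [Set.mem_ofPred_eq, not_le] at hx
    exact hνd x (by linarith)
  have hcν : Continuous fun x => extDeriv ν x b :=
    (ContinuousAlternatingMap.apply ℝ V ℝ (b : Fin (p + 1) → V)).continuous.comp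
      (continuous_iff_continuousAt.2 fun x => (contDiffAt_extDeriv hνs.contDiffAt).continuousAt)
  have := hcν.integral_pos_of_hasCompactSupport_nonneg_nonzero (μ := Measure.addHaar) hνc' hnn hpos
  rw [integral_extDeriv_apply_eq_zero (hνs.of_le (by exact_mod_cast le_top)) hνc] at this
  exact lt_irrefl _ this

end Stokes

/-! ### Positivity of powers of a two-form on paired frames -/

section WedgePow

open Equiv

variable {V : Type*} [AddCommGroup V] [Module ℝ V]

/-- Each shuffle class contains `p! q!` permutations with the same contribution. A sum over all
permutations is easier to regroup than one over shuffles. -/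
theorem factorial_mul_wedge {p q : ℕ} (a : V [⋀^Fin p]→ₗ[ℝ] ℝ) (b : V [⋀^Fin q]→ₗ[ℝ] ℝ)
    (v : Fin (p + q) → V) :
    (p.factorial * q.factorial : ℕ) * wedge a b v =
      ∑ σ : Perm (Fin p ⊕ Fin q), ((Perm.sign σ : ℤ) : ℝ) *
        (a (fun i => v (finSumFinEquiv (σ (Sum.inl i)))) *
          b (fun i => v (finSumFinEquiv (σ (Sum.inr i))))) := by
  have h := MultilinearMap.domCoprod_alternization_eq a b
  have h1 := congrArg (fun T => LinearMap.mul' ℝ ℝ (T (v ∘ finSumFinEquiv))) h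
  simp only [Fintype.card_fin] at h1
  rw [MultilinearMap.alternatization_apply, map_sum, AlternatingMap.smul_apply, map_nsmul,
    nsmul_eq_mul] at h1
  refine Eq.trans h1.symm (Finset.sum_congr rfl fun σ _ => ?_)
  rw [Units.smul_def, map_zsmul, zsmul_eq_mul]
  simp

/-- Every term of the expansion has a factor in which `v i` is paired with some vector of the tuple.
-/
theorem wedgePow_eq_zero {η : V [⋀^Fin 2]→ₗ[ℝ] ℝ} {k : ℕ} {v : Fin (2 * k) → V} {i : Fin (2 * k)}
    (h : ∀ a b, a = i ∨ b = i → η ![v a, v b] = 0) : wedgePow η k v = 0 := by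
  induction k with
  | zero => exact i.elim0
  | succ k ih =>
    have h1 := factorial_mul_wedge (wedgePow η k) η v
    rw [Finset.sum_eq_zero] at h1
    · exact (mul_eq_zero.1 h1).resolve_left (by positivity)
    intro σ _
    rw [mul_eq_zero, mul_eq_zero]
    right
    obtain ⟨s, hs⟩ : ∃ s, finSumFinEquiv (σ s) = i := ⟨σ.symm (finSumFinEquiv.symm i), by simp⟩
    rcases s with s | s
    · left
      exact ih (i := s) fun a b hab => h _ _ (by rcases hab with rfl | rfl <;> simp [hs])
    · right
      have h2 := h (finSumFinEquiv (σ (Sum.inr 0))) (finSumFinEquiv (σ (Sum.inr 1)))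
        (by fin_cases s <;> simp at hs <;> simp [hs])
      convert h2 using 2
      funext j; fin_cases j <;> rfl

/-- A tuple of vectors split into consecutive pairs which are mutually orthogonal and positive with
respect to a two-form. -/
structure IsPairFrame (η : V [⋀^Fin 2]→ₗ[ℝ] ℝ) {k : ℕ} (t : Fin (2 * k) → V) : Prop where
  orth : ∀ a b : Fin (2 * k), (a : ℕ) / 2 ≠ b / 2 → η ![t a, t b] = 0
  pos : ∀ a b : Fin (2 * k), (a : ℕ) % 2 = 0 → (b : ℕ) = a + 1 → 0 < η ![t a, t b]

theorem IsPairFrame.comp {η : V [⋀^Fin 2]→ₗ[ℝ] ℝ} {k k' : ℕ} {t : Fin (2 * k) → V}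
    (h : IsPairFrame η t) {φ : Fin (2 * k') → Fin (2 * k)}
    (h1 : ∀ a b : Fin (2 * k'), (φ a : ℕ) / 2 = φ b / 2 → (a : ℕ) / 2 = b / 2)
    (h2 : ∀ a b : Fin (2 * k'), (a : ℕ) % 2 = 0 → (b : ℕ) = a + 1 → (φ a : ℕ) % 2 = 0 ∧ (φ b : ℕ) = φ a + 1) :
    IsPairFrame η (fun i => t (φ i)) :=
  ⟨fun a b hab => h.orth _ _ fun e => hab (h1 a b e),
    fun a b ha hb => h.pos _ _ (h2 a b ha hb).1 (h2 a b ha hb).2⟩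

/-- Induction on the number of pairs. A permutation contributes only if it places a whole pair into
the last factor. Exchanging that pair with the final one is an even permutation, so the contribution
is a product of the inductive value and a positive value of `η`. -/
theorem IsPairFrame.wedgePow_pos {η : V [⋀^Fin 2]→ₗ[ℝ] ℝ} {k : ℕ} {t : Fin (2 * k) → V}
    (h : IsPairFrame η t) : 0 < wedgePow η k t := by
  induction k with
  | zero => simp [wedgePow]
  | succ k ih =>
    let e : Fin (2 * k) ⊕ Fin 2 ≃ Fin (2 * (k + 1)) := finSumFinEquiv
    have el : ∀ i, (e (Sum.inl i) : ℕ) = i := fun i => rfl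
    have er : ∀ i, (e (Sum.inr i) : ℕ) = 2 * k + i := fun i => rfl
    let T : Perm (Fin (2 * k) ⊕ Fin 2) → ℝ := fun σ => ((Perm.sign σ : ℤ) : ℝ) *
        (wedgePow η k (fun i => t (e (σ (Sum.inl i)))) * η (fun i => t (e (σ (Sum.inr i)))))
    have hsum : (((2 * k).factorial * (2 : ℕ).factorial : ℕ) : ℝ) * wedgePow η (k + 1) t =
        ∑ σ, T σ := factorial_mul_wedge (wedgePow η k) η t
    -- Permuting within the two factors changes the sign of the permutation and the value of the
    -- forms alike, so the term depends only on the coset.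
    have hmul : ∀ (s : Perm (Fin (2 * k) ⊕ Fin 2)) (ρ : Perm (Fin (2 * k))) (τ : Perm (Fin 2)),
        T (s * Equiv.sumCongr ρ τ) = T s := by
      intro s ρ τ
      have h1 := (wedgePow η k).map_perm (fun i => t (e (s (Sum.inl i)))) ρ
      have h2 := η.map_perm (fun i => t (e (s (Sum.inr i)))) τ
      have h3 : ∀ {n : ℕ} (π : Perm (Fin n)), ((Perm.sign π : ℤ) : ℝ) * ((Perm.sign π : ℤ) : ℝ) =
          1 := by
        intro n π
        rw [← Int.cast_mul, Int.units_coe_mul_self, Int.cast_one]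
      simp only [Function.comp_def, Units.smul_def, zsmul_eq_mul] at h1 h2
      simp only [T, Perm.coe_mul, Function.comp_apply, Equiv.sumCongr_apply, Sum.map_inl,
        Sum.map_inr, h1, h2, Perm.sign_mul, Perm.sign_sumCongr, Units.val_mul, Int.cast_mul]
      linear_combination ((Perm.sign s : ℤ) : ℝ) * wedgePow η k (fun i => t (e (s (Sum.inl i)))) *
        η (fun i => t (e (s (Sum.inr i)))) * (((Perm.sign τ : ℤ) : ℝ) * ((Perm.sign τ : ℤ) : ℝ)) * h3 ρ
        + ((Perm.sign s : ℤ) : ℝ) * wedgePow η k (fun i => t (e (s (Sum.inl i)))) *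
        η (fun i => t (e (s (Sum.inr i)))) * h3 τ
    -- moving an arbitrary pair to the last position
    have hpair : ∀ r : ℕ, r ≤ k → ∃ s : Perm (Fin (2 * k) ⊕ Fin 2),
        (∀ j, (e (s (Sum.inr j)) : ℕ) = 2 * r + j) ∧ 0 < T s := by
      intro r hr
      have hr0 : 2 * r < 2 * (k + 1) := by omega
      have hr1 : 2 * r + 1 < 2 * (k + 1) := by omega
      let a := e.symm ⟨2 * r, hr0⟩
      let b := e.symm ⟨2 * r + 1, hr1⟩
      have ea : (e a : ℕ) = 2 * r := by simp [a]
      have eb : (e b : ℕ) = 2 * r + 1 := by simp [b]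
      have hab : a ≠ b := fun h => by rw [h, eb] at ea; omega
      have ha1 : a ≠ Sum.inr 1 := fun h => by rw [h, er] at ea; simp at ea; omega
      have hb0 : b ≠ Sum.inr 0 := fun h => by rw [h, er] at eb; simp at eb; omega
      have ha0 : a = Sum.inr 0 ↔ r = k := by
        rw [← e.injective.eq_iff, Fin.ext_iff, ea, er]; simp
      have hb1 : b = Sum.inr 1 ↔ r = k := by
        rw [← e.injective.eq_iff, Fin.ext_iff, eb, er]; simp
      let s : Perm (Fin (2 * k) ⊕ Fin 2) := swap a (Sum.inr 0) * swap b (Sum.inr 1)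
      have hsign : Perm.sign s = 1 := by
        by_cases hk : r = k
        · simp [s, ha0.2 hk, hb1.2 hk]
        · rw [Perm.sign_mul, Perm.sign_swap (fun h => hk (ha0.1 h)),
            Perm.sign_swap (fun h => hk (hb1.1 h))]; rfl
      have s0 : s (Sum.inr 0) = a := by
        simp only [s, Perm.mul_apply]
        rw [swap_apply_of_ne_of_ne hb0.symm (by simp), swap_apply_right]
      have s1 : s (Sum.inr 1) = b := by
        simp only [s, Perm.mul_apply]
        rw [swap_apply_right, swap_apply_of_ne_of_ne hab.symm hb0]
      have sl : ∀ i : Fin (2 * k), (e (s (Sum.inl i)) : ℕ) = if (i : ℕ) = 2 * r then 2 * k else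
          if (i : ℕ) = 2 * r + 1 then 2 * k + 1 else i := by
        intro i
        have hia : Sum.inl i = a ↔ (i : ℕ) = 2 * r := by
          rw [← e.injective.eq_iff, Fin.ext_iff, ea, el]
        have hib : Sum.inl i = b ↔ (i : ℕ) = 2 * r + 1 := by
          rw [← e.injective.eq_iff, Fin.ext_iff, eb, el]
        simp only [s, Perm.mul_apply]
        split_ifs with h1 h2
        · rw [hia.2 h1, swap_apply_of_ne_of_ne hab ha1, swap_apply_left, er]; rfl
        · rw [hib.2 h2, swap_apply_left, swap_apply_of_ne_of_ne ha1.symm (by simp), er]; rfl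
        · rw [swap_apply_of_ne_of_ne (fun h => h2 (hib.1 h)) (by simp),
            swap_apply_of_ne_of_ne (fun h => h1 (hia.1 h)) (by simp), el]
      refine ⟨s, fun j => ?_, ?_⟩
      · fin_cases j
        · simp [s0, ea]
        · simp [s1, eb]
      · simp only [T, hsign, Units.val_one, Int.cast_one, one_mul]
        refine mul_pos (ih (h.comp (φ := fun i => e (s (Sum.inl i))) ?_ ?_)) ?_
        · intro x y hxy
          have hx := x.2
          have hy := y.2
          rw [sl, sl] at hxy
          split_ifs at hxy <;> omega
        · intro x y hx hxy
          rw [sl, sl]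
          split_ifs <;> omega
        · have := h.pos (e a) (e b) (by omega) (by omega)
          have he : (fun j => t (e (s (Sum.inr j)))) = ![t (e a), t (e b)] := by
            funext j; fin_cases j
            · exact congrArg (fun z => t (e z)) s0
            · exact congrArg (fun z => t (e z)) s1
          rwa [he]
    have hnn : ∀ σ, 0 ≤ T σ := by
      intro σ
      by_cases hσ : (e (σ (Sum.inr 0)) : ℕ) / 2 = e (σ (Sum.inr 1)) / 2
      · obtain ⟨s, hs, hpos⟩ := hpair ((e (σ (Sum.inr 0)) : ℕ) / 2) (by omega)
        have hne : (e (σ (Sum.inr 0)) : ℕ) ≠ e (σ (Sum.inr 1)) := by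
          rw [Ne, ← Fin.ext_iff, e.injective.eq_iff, σ.injective.eq_iff]; simp
        -- `σ` and the model permutation `s` put the same pair into the last factor, so they differ
        -- by a permutation preserving the two blocks.
        have hmaps : Set.MapsTo (s⁻¹ * σ) (Set.range Sum.inr) (Set.range Sum.inr) := by
          rintro _ ⟨j, rfl⟩
          have h0 := hs 0
          have h1 := hs 1
          simp only [Fin.val_zero, Fin.val_one] at h0 h1
          have : σ (Sum.inr j) = s (Sum.inr 0) ∨ σ (Sum.inr j) = s (Sum.inr 1) := by
            simp only [← e.injective.eq_iff, Fin.ext_iff, h0, h1]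
            fin_cases j <;> simp <;> omega
          rcases this with h | h
          · exact ⟨0, by simp [h]⟩
          · exact ⟨1, by simp [h]⟩
        obtain ⟨⟨ρ, τ⟩, hρ⟩ := Perm.mem_sumCongrHom_range_of_perm_mapsTo_inl
          ((Perm.perm_mapsTo_inl_iff_mapsTo_inr _).2 hmaps)
        have : σ = s * Equiv.sumCongr ρ τ := by
          rw [← inv_mul_eq_iff_eq_mul]; exact hρ.symm
        rw [this, hmul]
        exact hpos.le
      · have h0 : η (fun i => t (e (σ (Sum.inr i)))) = 0 := by
          rw [← h.orth _ _ hσ]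
          congr 1
          funext j; fin_cases j <;> rfl
        simp [T, h0]
    have hpos : 0 < ∑ σ, T σ := by
      obtain ⟨s, -, hs⟩ := hpair k le_rfl
      exact Finset.sum_pos' (fun σ _ => hnn σ) ⟨s, Finset.mem_univ _, hs⟩
    rw [← hsum] at hpos
    exact pos_of_mul_pos_right hpos (by positivity)

end WedgePow

/-! ### The differential of a linear one-form wedged with a form -/

section OneForm

variable {V : Type*} [NormedAddCommGroup V] [InnerProductSpace ℝ V] [FiniteDimensional ℝ V] {p : ℕ}

/-- The exterior derivative of `θ ∧ β` at a tuple on which `dβ` vanishes, where `θ = ⟨Ax, dx⟩` for a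
skew-symmetric operator `A`. -/
theorem extDeriv_wedgeOne_innerSL_apply {A : V →L[ℝ] V} (hA : ∀ u v, ⟪A u, v⟫_ℝ = -⟪u, A v⟫_ℝ)
    {β : V → V [⋀^Fin p]→L[ℝ] ℝ} {x : V} (hβ : ContDiffAt ℝ ∞ β x) {t : Fin (p + 2) → V}
    (ht : ∀ i : Fin (p + 2), extDeriv β x (i.removeNth t) = 0) :
    extDeriv (fun y => wedgeOne (innerSL ℝ (A y)) (β y)) x t =
      ∑ i : Fin (p + 1), ∑ j ≥ i, (-1) ^ (i + j : ℕ) *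
        (2 * ⟪A (t i.castSucc), t j.succ⟫_ℝ * β x (j.removeNth (i.castSucc.removeNth t))) := by
  let e := stdOrthonormalBasis ℝ V
  let c : Fin (Module.finrank ℝ V) → V →L[ℝ] ℝ := fun j => innerSL ℝ (e j) ∘L A
  have hd : ∀ j y, fderiv ℝ (innerSL ℝ (e j)) y = innerSL ℝ (e j) := fun j y =>
    ContinuousLinearMap.fderiv _
  -- In an orthonormal basis `θ = ∑ c_j de_j` with linear coefficients `c_j = ⟨e_j, A·⟩`, so `θ ∧ β
  -- = ∑ de_j ∧ (c_j β)` and the rule for `d(dF ∧ ·)` applies termwise.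
  have h1 : (fun y => wedgeOne (innerSL ℝ (A y)) (β y)) =
      fun y => ∑ j, wedgeOne (fderiv ℝ (innerSL ℝ (e j)) y) (c j y • β y) := by
    funext y
    have : innerSL ℝ (A y) = ∑ j, c j y • innerSL ℝ (e j) := by
      conv_lhs => rw [← e.sum_repr' (A y)]
      simp [c]
    rw [this, wedgeOne_sum_left]
    exact Finset.sum_congr rfl fun j _ => by rw [hd, wedgeOne_smul_left, wedgeOne_smul_right]
  have hs : ∀ j, ContDiffAt ℝ ∞ (fun y => c j y • β y) x := fun j =>
    (c j).contDiff.contDiffAt.smul hβ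
  have h2 : extDeriv (fun y => wedgeOne (innerSL ℝ (A y)) (β y)) x =
      ∑ j, -wedgeOne (innerSL ℝ (e j)) (wedgeOne (c j) (β x) + c j x • extDeriv β x) := by
    rw [h1, extDeriv, fderiv_fun_sum]
    · rw [← ContinuousAlternatingMap.alternatizeUncurryFinCLM_apply, map_sum]
      refine Finset.sum_congr rfl fun j _ => ?_
      have := extDeriv_wedgeOne_fderiv (innerSL ℝ (e j)).contDiff.contDiffAt (hs j)
      rw [extDeriv_smul_of_differentiableAt (c j).differentiableAt
        (hβ.differentiableAt (by simp)), (c j).fderiv, hd] at this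
      exact this
    · intro j _
      simp only [hd]
      exact (contDiffAt_wedgeOne contDiffAt_const (hs j)).differentiableAt (by simp)
  -- This is `∑ de_j ∧ dc_j = -dθ`; skewness of `A` merges the two halves and produces the factor 2.
  have h3 : ∀ u v : V, ∑ j, (⟪e j, u⟫_ℝ * c j v - ⟪e j, v⟫_ℝ * c j u) = -(2 * ⟪A u, v⟫_ℝ) := by
    intro u v
    have h4 : ∀ u v : V, ∑ j, ⟪e j, u⟫_ℝ * c j v = ⟪u, A v⟫_ℝ := fun u v => by
      rw [← e.sum_inner_mul_inner u (A v)]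
      exact Finset.sum_congr rfl fun j _ => by rw [real_inner_comm]; rfl
    rw [Finset.sum_sub_distrib, h4, h4, ← neg_eq_iff_eq_neg.2 (hA u v), real_inner_comm v (A u)]
    ring
  rw [h2, ContinuousAlternatingMap.sum_apply]
  simp only [wedgeOne_add_right, wedgeOne_smul_right, ContinuousAlternatingMap.neg_apply,
    ContinuousAlternatingMap.add_apply, ContinuousAlternatingMap.smul_apply,
    wedgeOne_eq_zero_of_forall ht, smul_zero, add_zero, wedgeOne_wedgeOne_apply,
    Finset.sum_neg_distrib]
  rw [Finset.sum_comm, ← Finset.sum_neg_distrib]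
  refine Finset.sum_congr rfl fun i _ => ?_
  rw [Finset.sum_comm, ← Finset.sum_neg_distrib]
  refine Finset.sum_congr rfl fun j _ => ?_
  simp only [innerSL_apply_apply]
  rw [← Finset.mul_sum, ← Finset.sum_mul, h3]
  ring

end OneForm

/-! ### Removing two vectors from a paired frame -/

section PairFrame

variable {V : Type*} [AddCommGroup V] [Module ℝ V] {η : V [⋀^Fin 2]→ₗ[ℝ] ℝ} {k : ℕ}
  {t : Fin (2 * (k + 1)) → V}

/-- The number of the element of `Fin (2 * (k + 1))` that remains at place `a` when the elements at
places `i` and `j + 1` are removed. -/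
theorem val_succAbove_succAbove (i j : Fin (2 * k + 1)) (hij : i ≤ j) (a : Fin (2 * k)) :
    (i.castSucc.succAbove (j.succAbove a) : ℕ) =
      if (a : ℕ) < i then (a : ℕ) else if (a : ℕ) < j then a + 1 else a + 2 := by
  have h : (i : ℕ) ≤ j := hij
  simp only [Fin.succAbove, Fin.lt_def]
  split_ifs <;> simp_all <;> omega

theorem IsPairFrame.wedgePow_removeNth_pos (h : IsPairFrame η t) {i : Fin (2 * k + 1)}
    (hi : (i : ℕ) % 2 = 0) :
    0 < wedgePow η k (i.removeNth (i.castSucc.removeNth (α := fun _ => V) t)) := by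
  refine (h.comp (φ := fun a => i.castSucc.succAbove (i.succAbove a)) ?_ ?_).wedgePow_pos
  · intro a b hab
    rw [val_succAbove_succAbove i i le_rfl, val_succAbove_succAbove i i le_rfl] at hab
    split_ifs at hab <;> omega
  · intro a b ha hb
    rw [val_succAbove_succAbove i i le_rfl, val_succAbove_succAbove i i le_rfl]
    split_ifs <;> omega

/-- Unless the two removed places `i` and `j + 1` form a pair, the partner of `i` survives and is
`η`-orthogonal to all that remains. -/
theorem IsPairFrame.wedgePow_removeNth_eq_zero (h : IsPairFrame η t) {i j : Fin (2 * k + 1)}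
    (hij : i ≤ j) (hne : ¬ ((i : ℕ) % 2 = 0 ∧ i = j)) :
    wedgePow η k (j.removeNth (i.castSucc.removeNth (α := fun _ => V) t)) = 0 := by
  have hij' : (i : ℕ) ≤ j := hij
  have hval := val_succAbove_succAbove i j hij
  have hj := j.2
  have hx : ∀ a : Fin (2 * k), (i.castSucc.succAbove (j.succAbove a) : ℕ) ≠ i := by
    intro a
    rw [hval]
    split_ifs <;> omega
  have hne' : ¬ ((i : ℕ) % 2 = 0 ∧ (i : ℕ) = j) := fun h => hne ⟨h.1, Fin.ext h.2⟩
  -- The partner is at `i + 1` for even `i`, and moves to place `i` after the removal; for odd `i`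
  -- it is at `i - 1` and keeps its place.
  obtain ⟨c, hc⟩ : ∃ c : Fin (2 * k), (i.castSucc.succAbove (j.succAbove c) : ℕ) =
      if (i : ℕ) % 2 = 0 then (i : ℕ) + 1 else i - 1 := by
    by_cases hi : (i : ℕ) % 2 = 0
    · refine ⟨⟨i, by omega⟩, ?_⟩
      rw [hval]; simp only; split_ifs <;> omega
    · refine ⟨⟨i - 1, by omega⟩, ?_⟩
      rw [hval]; simp only; split_ifs <;> omega
  have hself : ∀ v : V, η ![v, v] = 0 := fun v =>
    η.map_eq_zero_of_eq _ (i := 0) (j := 1) rfl (by decide)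
  have key : ∀ a : Fin (2 * k), a ≠ c → (i.castSucc.succAbove (j.succAbove a) : ℕ) / 2 ≠
      (i.castSucc.succAbove (j.succAbove c) : ℕ) / 2 := by
    intro a hac h1
    have h2 : (i.castSucc.succAbove (j.succAbove a) : ℕ) ≠
        i.castSucc.succAbove (j.succAbove c) := fun h3 =>
      hac (Fin.succAbove_right_injective (Fin.succAbove_right_injective (Fin.ext h3)))
    have h3 := hx a
    rw [hc] at h1 h2
    split_ifs at h1 h2 <;> omega
  refine wedgePow_eq_zero (i := c) fun a b hab => ?_
  rcases hab with rfl | rfl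
  · by_cases hb : b = a
    · subst hb; exact hself _
    · exact h.orth _ _ (key b hb).symm
  · by_cases hb : a = b
    · subst hb; exact hself _
    · exact h.orth _ _ (key a hb)

end PairFrame

/-! ### Hermitian orthogonal frames -/

section Unitary

variable {V : Type*} [AddCommGroup V] [Module ℝ V]

/-- Gram–Schmidt by dimension count: orthogonality to all `w i` and `J (w i)` imposes `2(k + 1)`
linear conditions on a larger space. Prescribing the first vector later allows a direction where
`dθ` is strictly positive. -/
theorem exists_hermitian_orthogonal [FiniteDimensional ℝ V] {g : V →ₗ[ℝ] V →ₗ[ℝ] ℝ} {J : V →ₗ[ℝ] V}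
    (hs : ∀ v w, g v w = g w v) (hJ : ∀ v, J (J v) = -v) (hg : ∀ v w, g (J v) (J w) = g v w)
    {v₀ : V} (hv : v₀ ≠ 0) (k : ℕ) (hk : 2 * (k + 1) ≤ Module.finrank ℝ V) :
    ∃ w : Fin (k + 1) → V, w 0 = v₀ ∧ (∀ i, w i ≠ 0) ∧
      ∀ i j, i ≠ j → g (w i) (w j) = 0 ∧ g (J (w i)) (w j) = 0 := by
  induction k with
  | zero => exact ⟨fun _ => v₀, rfl, fun _ => hv, fun i j hij => absurd (Fin.ext (by omega)) hij⟩
  | succ k ih =>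
    obtain ⟨w, hw0, hw, hw'⟩ := ih (by omega)
    let L : V →ₗ[ℝ] (Fin (k + 1) → ℝ) × (Fin (k + 1) → ℝ) :=
      (LinearMap.pi fun i => g (w i)).prod (LinearMap.pi fun i => g (J (w i)))
    have hL := LinearMap.ker_ne_bot_of_finrank_lt (f := L) (by simp; omega)
    obtain ⟨u, hu, hu0⟩ := (Submodule.ne_bot_iff _).1 hL
    have hu1 : ∀ i, g (w i) u = 0 := fun i => congrFun (congrArg Prod.fst hu) i
    have hu2 : ∀ i, g (J (w i)) u = 0 := fun i => congrFun (congrArg Prod.snd hu) i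
    refine ⟨Fin.snoc (α := fun _ => V) w u, ?_, ?_, ?_⟩
    · rw [← Fin.castSucc_zero, Fin.snoc_castSucc, hw0]
    · intro i
      refine Fin.lastCases ?_ (fun i => ?_) i
      · simpa using hu0
      · simpa using hw i
    · intro i j
      refine Fin.lastCases ?_ (fun i => ?_) i <;> refine Fin.lastCases ?_ (fun j => ?_) j
      · exact fun h => absurd rfl h
      · intro _
        simp only [Fin.snoc_last, Fin.snoc_castSucc]
        refine ⟨by rw [hs, hu1], ?_⟩
        rw [← hg, hJ, map_neg, LinearMap.neg_apply, hs, hu2, neg_zero]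
      · intro _
        simp [hu1, hu2]
      · intro h
        simpa using hw' i j fun e => h (by rw [e])

/-- The tuple `(w_0, J w_0, w_1, J w_1, …)`. -/
def pairTuple (J : V →ₗ[ℝ] V) {k : ℕ} (w : Fin k → V) (s : Fin (2 * k)) : V :=
  if (s : ℕ) % 2 = 0 then w ⟨s / 2, by omega⟩ else J (w ⟨s / 2, by omega⟩)

theorem isPairFrame_pairTuple {g : V →ₗ[ℝ] V →ₗ[ℝ] ℝ} {J : V →ₗ[ℝ] V}
    (hp : ∀ v, v ≠ 0 → 0 < g v v)
    (hJ : ∀ v, J (J v) = -v) (hg : ∀ v w, g (J v) (J w) = g v w)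
    {η : V [⋀^Fin 2]→ₗ[ℝ] ℝ} (hη : ∀ v w, η ![v, w] = g (J v) w) {k : ℕ} {w : Fin k → V}
    (hw : ∀ i, w i ≠ 0) (hw' : ∀ i j, i ≠ j → g (w i) (w j) = 0 ∧ g (J (w i)) (w j) = 0) :
    IsPairFrame η (pairTuple J w) := by
  constructor
  · intro a b hab
    have hab' : (⟨a / 2, by omega⟩ : Fin k) ≠ ⟨b / 2, by omega⟩ := fun h => hab (by simpa using h)
    obtain ⟨h1, h2⟩ := hw' _ _ hab'
    rw [hη]
    unfold pairTuple
    split_ifs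
    · exact h2
    · rw [hg, h1]
    · rw [hJ, map_neg, LinearMap.neg_apply, h1, neg_zero]
    · rw [hg, h2]
  · intro a b ha hb
    have hb1 : ¬ (b : ℕ) % 2 = 0 := by omega
    have hb2 : (⟨b / 2, by omega⟩ : Fin k) = ⟨a / 2, by omega⟩ := Fin.ext (by simp only; omega)
    rw [hη, pairTuple, pairTuple, if_pos ha, if_neg hb1, hb2, hg]
    exact hp _ (hw _)

end Unitary

/-! ### Defining functions of `M_+` and the obstruction to balanced metrics -/

namespace CliffordSystem

variable {m l : ℕ} (P : CliffordSystem m l)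

/-- The normal vectors `P_0 x, …, P_m x, x` (and `x` for all larger indices). -/
noncomputable def normalVec (i : ℕ) : E l →L[ℝ] E l := if h : i < m + 1 then P.op ⟨i, h⟩ else 1

/-- The defining functions `⟨P_0 x, x⟩, …, ⟨P_m x, x⟩, |x|² - 1` of `M_+`. -/
noncomputable def defFun (i : ℕ) (x : E l) : ℝ :=
  ⟪P.normalVec i x, x⟫_ℝ - if i < m + 1 then 0 else 1

theorem normalVec_symm (i : ℕ) (x y : E l) : ⟪P.normalVec i x, y⟫_ℝ = ⟪x, P.normalVec i y⟫_ℝ := by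
  unfold normalVec
  split_ifs
  · exact P.op_inner _ _ _
  · rfl

theorem hasFDerivAt_defFun (i : ℕ) (x : E l) :
    HasFDerivAt (P.defFun i) ((2 : ℝ) • innerSL ℝ (P.normalVec i x)) x := by
  have h := ((P.normalVec i).hasFDerivAt (x := x)).inner ℝ (hasFDerivAt_id x)
  have h2 := h.sub_const (if i < m + 1 then (0 : ℝ) else 1)
  refine h2.congr_fderiv ?_
  ext v
  have := P.normalVec_symm i v x
  rw [real_inner_comm] at this
  simp [fderivInnerCLM_apply, this, real_inner_comm v (P.normalVec i x),
    real_inner_comm x (P.normalVec i v)]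
  ring

theorem fderiv_defFun_apply (i : ℕ) (x v : E l) :
    fderiv ℝ (P.defFun i) x v = 2 * ⟪P.normalVec i x, v⟫_ℝ := by
  rw [(P.hasFDerivAt_defFun i x).fderiv]; rfl

theorem contDiff_defFun (i : ℕ) : ContDiff ℝ ∞ (P.defFun i) :=
  ((P.normalVec i).contDiff.inner ℝ contDiff_id).sub contDiff_const

theorem mem_MPlus_iff_defFun {x : E l} : x ∈ P.MPlus ↔ ∀ i < m + 2, P.defFun i x = 0 := by
  rw [mem_MPlus_iff]
  have hlast : P.defFun (m + 1) x = ‖x‖ ^ 2 - 1 := by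
    simp [defFun, normalVec]
  have hi : ∀ i : Fin (m + 1), P.defFun i x = ⟪x, P.op i x⟫_ℝ := by
    intro i
    simp [defFun, normalVec, P.op_inner, i.2]
  constructor
  · rintro ⟨h1, h2⟩ i hi'
    rcases Nat.lt_succ_iff_lt_or_eq.1 hi' with h | rfl
    · rw [hi ⟨i, h⟩, h2]
    · rw [hlast, h1]; norm_num
  · intro h
    refine ⟨?_, fun i => by rw [← hi, h _ (by omega)]⟩
    have h1 := h (m + 1) (by omega)
    rw [hlast, sub_eq_zero] at h1
    exact (pow_eq_one_iff_of_nonneg (norm_nonneg x) two_ne_zero).1 h1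

theorem inner_normalVec {x : E l} (hx : x ∈ P.MPlus) {i j : ℕ} (hi : i < m + 2) (hj : j < m + 2) :
    ⟪P.normalVec i x, P.normalVec j x⟫_ℝ = if i = j then 1 else 0 := by
  obtain ⟨h1, h2⟩ := P.mem_MPlus_iff.1 hx
  have h3 := fun i : Fin (m + 1) => (P.op_inner i x x).trans (h2 i)
  unfold normalVec
  split_ifs with h4 h5 h6 h6 h6 h6 <;> first | omega | skip
  · subst h6
    simp [P.norm_op, h1]
  · rw [P.op_inner, P.inner_op_op]
    simpa using h6
  · simp [h3]
  · simp [h2]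
  · simp [h1]

theorem inner_normalVec_tangent {x v : E l} (hv : v ∈ P.tangent x) (i : ℕ) :
    ⟪P.normalVec i x, v⟫_ℝ = 0 := by
  obtain ⟨h1, h2⟩ := P.mem_tangent_iff.1 hv
  unfold normalVec
  rw [real_inner_comm]
  split_ifs
  · exact h2 _
  · exact h1

theorem isCompact_sum_defFun_sq :
    IsCompact {x : E l | ∑ i ∈ Finset.range (m + 2), P.defFun i x ^ 2 ≤ 1} := by
  refine Metric.isCompact_of_isClosed_isBounded ?_ ?_
  · refine isClosed_le ?_ continuous_const
    exact continuous_finsetSum _ fun i _ => (P.contDiff_defFun i).continuous.pow 2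
  · refine (Metric.isBounded_closedBall (x := (0 : E l)) (r := 2)).subset fun x hx => ?_
    have h1 : P.defFun (m + 1) x ^ 2 ≤ 1 :=
      (Finset.single_le_sum (f := fun i => P.defFun i x ^ 2) (fun i _ => sq_nonneg _)
        (by simp : m + 1 ∈ Finset.range (m + 2))).trans hx
    have hlast : P.defFun (m + 1) x = ‖x‖ ^ 2 - 1 := by
      simp [defFun, normalVec]
    rw [hlast] at h1
    rw [mem_closedBall_zero_iff]
    have h2 := (abs_le.1 ((sq_le_one_iff_abs_le_one _).1 h1)).2
    nlinarith [norm_nonneg x]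

/-- A Hermitian metric on `M_+` is not balanced if `M_+` carries a one-form `⟨Ax, dx⟩` whose
differential is semipositive with respect to `J` and vanishes nowhere. -/
theorem not_isBalanced_of_semipositive {P : CliffordSystem m l} {J : P.AlmostComplexStructure}
    (h : HermitianMetric J) (hl : 2 * l = 2 * (P.complexDim - 1) + 2 + (m + 2))
    (hne : P.MPlus.Nonempty) {A : E l →L[ℝ] E l} (hA : ∀ u v, ⟪A u, v⟫_ℝ = -⟪u, A v⟫_ℝ)
    (h0 : ∀ (x : P.MPlus) (w : P.tangent x), 0 ≤ ⟪A w, (J.J x w : E l)⟫_ℝ)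
    (h1 : ∀ x : P.MPlus, ∃ w : P.tangent x, 0 < ⟪A w, (J.J x w : E l)⟫_ℝ) : ¬ h.IsBalanced := by
  rintro ⟨U, β, hU, hMU, hβ, hβω, hdβ⟩
  -- `hl` makes the dimension of `M_+` equal to `2(k + 1)`, so neither the truncated subtraction nor
  -- the halving in `complexDim` loses anything.
  generalize hk : P.complexDim - 1 = k at hl β hβ hβω hdβ
  let G : E l → ℝ := fun x => ∑ i ∈ Finset.range (m + 2), P.defFun i x ^ 2
  have hG : ∀ x, G x = 0 ↔ x ∈ P.MPlus := by
    intro x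
    rw [P.mem_MPlus_iff_defFun, Finset.sum_eq_zero_iff_of_nonneg fun i _ => sq_nonneg _]
    simp
  let γ : E l → E l [⋀^Fin (2 * k + 1)]→L[ℝ] ℝ := fun x => wedgeOne (innerSL ℝ (A x)) (β x)
  have hβ' : ∀ x ∈ U, ContDiffAt ℝ ∞ β x := fun x hx => hβ.contDiffAt (hU.mem_nhds hx)
  have hγ : ∀ x ∈ U, ContDiffAt ℝ ∞ γ x := fun x hx =>
    contDiffAt_wedgeOne ((innerSL ℝ ∘L A).contDiff.contDiffAt) (hβ' x hx)
  have hF : ∀ x i, ContDiffAt ℝ ∞ (P.defFun i) x := fun x i => (P.contDiff_defFun i).contDiffAt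
  obtain ⟨x, hx, hdx⟩ := exists_extDeriv_eq_zero (G := G) (U := U)
    (μ := wedgeFDeriv P.defFun γ (m + 2)) (by rw [finrank_euclideanSpace_fin]; omega)
    (ContDiff.sum fun i _ => (P.contDiff_defFun i).pow 2)
    (fun x => Finset.sum_nonneg fun i _ => sq_nonneg _) P.isCompact_sum_defFun_sq
    (hne.imp fun x hx => (hG x).2 hx) hU (fun x hx => hMU ((hG x).1 hx))
    (fun x hx => contDiffAt_wedgeFDeriv (hF x) (hγ x hx) _)
    (fun x hx => by
      -- `dG = ∑ 2 F_i dF_i`, and every `dF_i` already occurs as a factor of `μ`.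
      have : fderiv ℝ G x = ∑ i ∈ Finset.range (m + 2),
          (2 * P.defFun i x) • fderiv ℝ (P.defFun i) x := by
        have hd : ∀ i, DifferentiableAt ℝ (P.defFun i) x :=
          fun i => (hF x i).differentiableAt (by simp)
        refine (fderiv_fun_sum (A := fun i y => P.defFun i y ^ 2) fun i _ => (hd i).pow 2).trans ?_
        refine Finset.sum_congr rfl fun i _ => ?_
        rw [fderiv_fun_pow 2 (hd i)]
        simp
      rw [this, wedgeOne_sum_left]
      refine Finset.sum_eq_zero fun i hi => ?_
      rw [wedgeOne_smul_left, wedgeOne_wedgeFDeriv_of_lt (Finset.mem_range.1 hi), smul_zero])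
  rw [hG] at hx
  let y : P.MPlus := ⟨x, hx⟩
  obtain ⟨v₀, hv₀⟩ := h1 y
  have hv0 : v₀ ≠ 0 := by rintro rfl; simp at hv₀
  have hdim : 2 * (k + 1) ≤ Module.finrank ℝ (P.tangent x) := by
    rw [P.finrank_tangent hx]; omega
  obtain ⟨w, hw0, hw, hw'⟩ := exists_hermitian_orthogonal (h.symm y) (J.J_sq y) (h.hermitian y)
    hv0 k hdim
  have hfr : IsPairFrame (h.kahlerForm y) (pairTuple (J.J y) w) :=
    isPairFrame_pairTuple (h.pos y) (J.J_sq y) (h.hermitian y)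
      (fun v w => rfl) hw hw'
  set t : Fin (2 * (k + 1)) → P.tangent x := pairTuple (J.J y) w
  refine extDeriv_wedgeFDeriv_consTuple_ne_zero (n := fun i => P.normalVec i x)
    (t := fun i => (t i : E l)) (hF x) (hγ x (hMU hx)) ?_ ?_ ?_ ?_ hdx
  · intro i hi j hj
    rw [fderiv_defFun_apply, P.inner_normalVec hx hi (hj.trans hi), if_neg hj.ne', mul_zero]
  · intro i hi
    rw [fderiv_defFun_apply, P.inner_normalVec hx hi hi]; simp
  · intro i _ j
    rw [fderiv_defFun_apply, P.inner_normalVec_tangent (t j).2, mul_zero]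
  -- The balanced condition makes `dβ` vanish on tangent vectors at `x ∈ M_+`, which is all that is
  -- required of the extension `β`.
  · refine (extDeriv_wedgeOne_innerSL_apply hA (hβ' x (hMU hx)) (t := fun i => (t i : E l))
      (fun i => hdβ y (i.removeNth (α := fun _ => P.tangent x) t))).trans_ne ?_
    have hβt : ∀ i j : Fin (2 * k + 1), β x (j.removeNth (i.castSucc.removeNth fun i => (t i : E l)))
        = wedgePow (h.kahlerForm y) k
          (j.removeNth (i.castSucc.removeNth (α := fun _ => P.tangent x) t)) := fun i j => hβω y _
    have hA2 : ∀ i : Fin (2 * k + 1), (i : ℕ) % 2 = 0 →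
        ⟪A (t i.castSucc), (t i.succ : E l)⟫_ℝ =
          ⟪A (w ⟨i / 2, by omega⟩), (J.J y (w ⟨i / 2, by omega⟩) : E l)⟫_ℝ := by
      intro i hi
      have h3 : ¬ (i.succ : ℕ) % 2 = 0 := by simp; omega
      have h4 : (⟨(i.succ : ℕ) / 2, by omega⟩ : Fin (k + 1)) = ⟨i / 2, by omega⟩ :=
        Fin.ext (by simp; omega)
      have h5 : t i.castSucc = w ⟨i / 2, by omega⟩ := if_pos hi
      have h6 : t i.succ = J.J y (w ⟨i / 2, by omega⟩) := by
        rw [← h4]; exact if_neg h3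
      rw [h5, h6]
    have hdiag : ∀ i : Fin (2 * k + 1), (i : ℕ) % 2 = 0 → (-1 : ℝ) ^ (i + i : ℕ) *
        (2 * ⟪A (t i.castSucc), (t i.succ : E l)⟫_ℝ *
          β x (i.removeNth (i.castSucc.removeNth fun i => (t i : E l)))) =
        2 * ⟪A (w ⟨i / 2, by omega⟩), (J.J y (w ⟨i / 2, by omega⟩) : E l)⟫_ℝ *
          wedgePow (h.kahlerForm y) k
          (i.removeNth (i.castSucc.removeNth (α := fun _ => P.tangent x) t)) := by
      intro i hi
      rw [hβt, hA2 i hi, Even.neg_one_pow ⟨i, rfl⟩, one_mul]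
    have hnn : ∀ i : Fin (2 * k + 1), ∀ j ≥ i, 0 ≤ (-1 : ℝ) ^ (i + j : ℕ) *
        (2 * ⟪A (t i.castSucc), (t j.succ : E l)⟫_ℝ *
          β x (j.removeNth (i.castSucc.removeNth fun i => (t i : E l)))) := by
      intro i j hij
      by_cases hc : (i : ℕ) % 2 = 0 ∧ i = j
      · obtain ⟨hi, rfl⟩ := hc
        rw [hdiag i hi]
        exact mul_nonneg (mul_nonneg zero_le_two (h0 _ _)) (hfr.wedgePow_removeNth_pos hi).le
      · rw [hβt, hfr.wedgePow_removeNth_eq_zero hij hc, mul_zero, mul_zero]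
    -- All terms are nonnegative, and the term `i = j = 0` is strictly positive because the frame
    -- starts with `v₀`.
    refine (Finset.sum_pos' (fun i _ => Finset.sum_nonneg fun j hj =>
      hnn i j (Finset.mem_Ici.1 hj)) ⟨0, Finset.mem_univ _, ?_⟩).ne'
    refine Finset.sum_pos' (fun j hj => hnn 0 j (Finset.mem_Ici.1 hj)) ⟨0, by simp, ?_⟩
    rw [hdiag 0 rfl]
    refine mul_pos (mul_pos zero_lt_two ?_) (hfr.wedgePow_removeNth_pos rfl)
    have : (⟨((0 : Fin (2 * k + 1)) : ℕ) / 2, by omega⟩ : Fin (k + 1)) = 0 := by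
      apply Fin.ext; simp
    rw [this, hw0]
    exact hv₀

end CliffordSystem

/-! ### Semipositivity for block complex structures -/

section BlockJ

variable {V : Type*} [NormedAddCommGroup V] [InnerProductSpace ℝ V] {r : ℕ}
  {A : V →L[ℝ] V} {e f : Fin r → V} {T : Submodule ℝ V}

/-- Write `X = Y + ∑ (a_i e_i + b_i f_i)`. As `JX ∈ T`, the vectors `A e_i` and `A f_i` drop out on
the left; as `AY` is orthogonal to all `e_i`, `f_i`, what remains is `|AY|²`. -/
theorem IsBlock.inner_blockJ_nonneg (h : IsBlock A e f T) (he : ∀ i, ∀ v ∈ T, ⟪A (e i), v⟫_ℝ = 0)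
    (hf : ∀ i, ∀ v ∈ T, ⟪A (f i), v⟫_ℝ = 0) {X : V} (hX : X ∈ T) :
    0 ≤ ⟪A X, blockJ A e f X⟫_ℝ := by
  have hJ := (h.blockJ_mem_and_sq hX).1
  obtain ⟨Y, a, b, hY, h1, h2, rfl⟩ := h.exists_decomp hX
  obtain ⟨-, h4, h5⟩ := h.A_maps Y hY h1 h2
  have h3 : ⟪A (Y + ∑ i, (a i • e i + b i • f i)),
      blockJ A e f (Y + ∑ i, (a i • e i + b i • f i))⟫_ℝ =
        ⟪A Y, blockJ A e f (Y + ∑ i, (a i • e i + b i • f i))⟫_ℝ := by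
    simp only [map_add A, map_sum A, map_smul A, inner_add_left, sum_inner, inner_smul_left,
      he _ _ hJ, hf _ _ hJ]
    simp
  rw [h3]
  have h6 : blockJ A e f (Y + ∑ i, (a i • e i + b i • f i))
      = A Y + ∑ i, (a i • f i - b i • e i) := by
    simp [blockJ_of_orthogonal h1 h2, h.blockJ_e, h.blockJ_f, sub_eq_add_neg]
  rw [h6]
  simp only [inner_add_right, inner_sum, inner_sub_right, inner_smul_right, h4, h5]
  simp

/-- By dimension some nonzero `X ∈ T` is orthogonal to all `e_i`, `f_i`. There `J = A`, and `A` is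
injective because `A² = -1`. -/
theorem IsBlock.exists_inner_blockJ_pos [FiniteDimensional ℝ V] (h : IsBlock A e f T)
    (hr : 2 * r < Module.finrank ℝ T) : ∃ X ∈ T, 0 < ⟪A X, blockJ A e f X⟫_ℝ := by
  let L : T →ₗ[ℝ] (Fin r → ℝ) × (Fin r → ℝ) :=
    (LinearMap.pi fun i => (innerSL ℝ (e i)).toLinearMap ∘ₗ T.subtype).prod
      (LinearMap.pi fun i => (innerSL ℝ (f i)).toLinearMap ∘ₗ T.subtype)
  have hL := LinearMap.ker_ne_bot_of_finrank_lt (f := L) (by simp; omega)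
  obtain ⟨u, hu, hu0⟩ := (Submodule.ne_bot_iff _).1 hL
  have hu1 : ∀ i, ⟪(u : V), e i⟫_ℝ = 0 := fun i =>
    (real_inner_comm _ _).trans (congrFun (congrArg Prod.fst hu) i)
  have hu2 : ∀ i, ⟪(u : V), f i⟫_ℝ = 0 := fun i =>
    (real_inner_comm _ _).trans (congrFun (congrArg Prod.snd hu) i)
  refine ⟨u, u.2, ?_⟩
  rw [blockJ_of_orthogonal hu1 hu2, real_inner_self_pos]
  intro h0
  have h1 := h.A_sq u
  rw [h0, map_zero] at h1
  exact hu0 (Subtype.ext (neg_eq_zero.1 h1.symm))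

end BlockJ

/-! ### Nonemptiness of `M_+` and the two cases -/

namespace CliffordSystem

variable {m l : ℕ}

/-- `P_0` interchanges the `±1` eigenspaces of `P_m`, so each has dimension at least `l`. Take unit
vectors `w` in the negative one and `z` in the positive one with `z ⊥ P_i w` for `i < m`, which is
possible since `m < l`. Then `(z + w)/√2` lies in `M_+`: for `i < m` the operator `P_i` swaps the
eigenspaces, and for `P_m` the norms cancel. -/
theorem MPlus_nonempty (P : CliffordSystem m l) (hm : 0 < m) (hml : m < l) : P.MPlus.Nonempty := by
  let Q : E l →ₗ[ℝ] E l := (P.op (Fin.last m)).toLinearMap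
  let Kp : Submodule ℝ (E l) := LinearMap.ker (Q - 1)
  let Kn : Submodule ℝ (E l) := LinearMap.ker (Q + 1)
  have hKp : ∀ z, z ∈ Kp ↔ P.op (Fin.last m) z = z := fun z => sub_eq_zero
  have hKn : ∀ z, z ∈ Kn ↔ P.op (Fin.last m) z = -z := fun z => add_eq_zero_iff_eq_neg
  have hanti : ∀ i : Fin m, ∀ z, P.op (Fin.last m) (P.op i.castSucc z) =
      -P.op i.castSucc (P.op (Fin.last m) z) := fun i => P.op_anti (Fin.castSucc_lt_last i)
  have hinj : Function.Injective (P.op (Fin.castSucc ⟨0, hm⟩)).toLinearMap := fun a b hab => by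
    rw [← P.op_sq (Fin.castSucc ⟨0, hm⟩) a, ← P.op_sq (Fin.castSucc ⟨0, hm⟩) b]
    exact congrArg _ hab
  have hle1 : Module.finrank ℝ Kn ≤ Module.finrank ℝ Kp := by
    rw [(Submodule.equivMapOfInjective _ hinj Kn).finrank_eq]
    refine Submodule.finrank_mono ?_
    rintro _ ⟨z, hz, rfl⟩
    rw [hKp]
    simpa [(hKn z).1 hz] using hanti ⟨0, hm⟩ z
  have hle2 : Module.finrank ℝ Kp ≤ Module.finrank ℝ Kn := by
    rw [(Submodule.equivMapOfInjective _ hinj Kp).finrank_eq]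
    refine Submodule.finrank_mono ?_
    rintro _ ⟨z, hz, rfl⟩
    rw [hKn]
    simpa [(hKp z).1 hz] using hanti ⟨0, hm⟩ z
  have hsup : Kp ⊔ Kn = ⊤ := by
    rw [eq_top_iff]
    intro x _
    have h1 : (2 : ℝ)⁻¹ • (x + P.op (Fin.last m) x) ∈ Kp := by
      rw [hKp]; simp [P.op_sq, add_comm]
    have h2 : (2 : ℝ)⁻¹ • (x - P.op (Fin.last m) x) ∈ Kn := by
      rw [hKn]; simp [P.op_sq, ← smul_neg]
    have h3 := Submodule.add_mem_sup h1 h2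
    rwa [← smul_add, add_add_sub_cancel, ← two_smul ℝ, smul_smul, inv_mul_cancel₀ two_ne_zero,
      one_smul] at h3
  have hdim := Submodule.finrank_add_le_finrank_add_finrank Kp Kn
  rw [hsup, finrank_top, finrank_euclideanSpace_fin] at hdim
  obtain ⟨w, hw, hw1⟩ : ∃ w ∈ Kn, ‖w‖ = 1 := by
    obtain ⟨w, hw, hw0⟩ := Kn.ne_bot_iff.1 fun h => by rw [h, finrank_bot] at hle2; omega
    exact ⟨_, Kn.smul_mem ‖w‖⁻¹ hw, norm_smul_inv_norm (𝕜 := ℝ) hw0⟩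
  obtain ⟨z, hz, hz1, hzw⟩ : ∃ z ∈ Kp, ‖z‖ = 1 ∧ ∀ i : Fin m, ⟪P.op i.castSucc w, z⟫_ℝ = 0 := by
    let L : Kp →ₗ[ℝ] (Fin m → ℝ) :=
      LinearMap.pi fun i => (innerSL ℝ (P.op i.castSucc w)).toLinearMap ∘ₗ Kp.subtype
    have hL := LinearMap.ker_ne_bot_of_finrank_lt (f := L) (by simp; omega)
    obtain ⟨u, hu, hu0⟩ := (Submodule.ne_bot_iff _).1 hL
    have hu1 : ∀ i, ⟪P.op (Fin.castSucc i) w, (u : E l)⟫_ℝ = 0 := fun i => congrFun hu i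
    refine ⟨_, Kp.smul_mem ‖(u : E l)‖⁻¹ u.2,
      norm_smul_inv_norm (𝕜 := ℝ) fun h => hu0 (Subtype.ext h), fun i => ?_⟩
    rw [inner_smul_right, hu1, mul_zero]
  rw [hKn] at hw
  rw [hKp] at hz
  have horth : ⟪z, w⟫_ℝ = 0 := by
    have := P.op_inner (Fin.last m) z w
    rw [hz, hw, inner_neg_right] at this
    linarith
  have hzz : ∀ i : Fin m, ⟪z, P.op i.castSucc z⟫_ℝ = 0 := by
    intro i
    have := P.op_inner (Fin.last m) z (P.op i.castSucc z)
    rw [hanti, hz, inner_neg_right] at this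
    linarith
  have hww : ∀ i : Fin m, ⟪w, P.op i.castSucc w⟫_ℝ = 0 := by
    intro i
    have := P.op_inner (Fin.last m) w (P.op i.castSucc w)
    rw [hanti, hw, map_neg, neg_neg, inner_neg_left] at this
    linarith
  refine ⟨(√2)⁻¹ • (z + w), P.mem_MPlus_iff.2 ⟨?_, fun i => ?_⟩⟩
  · have : ‖z + w‖ = √2 := by
      rw [← Real.sqrt_sq (norm_nonneg (z + w)), norm_add_sq_real, horth, hz1, hw1]
      norm_num
    rw [norm_smul, this, norm_inv, Real.norm_of_nonneg (Real.sqrt_nonneg 2)]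
    exact inv_mul_cancel₀ (by simp)
  · rw [map_smul, inner_smul_left, inner_smul_right]
    suffices ⟪z + w, P.op i (z + w)⟫_ℝ = 0 by rw [this]; simp
    rw [map_add, inner_add_left, inner_add_right, inner_add_right]
    refine Fin.lastCases ?_ (fun i => ?_) i
    · rw [hz, hw, inner_neg_right, inner_neg_right, horth, real_inner_comm z w, horth,
        real_inner_self_eq_norm_sq, real_inner_self_eq_norm_sq, hz1, hw1]
      norm_num
    · have h1 := hzw i
      rw [P.op_inner] at h1
      rw [hzz, hww, ← P.op_inner _ z w, real_inner_comm w (P.op _ z), h1]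
      norm_num

theorem op_mul_op_skew (P : CliffordSystem m l) {i j : Fin (m + 1)} (hij : i < j) (u v : E l) :
    ⟪(P.op i * P.op j) u, v⟫_ℝ = -⟪u, (P.op i * P.op j) v⟫_ℝ := by
  rw [mul_apply_eq_comp, mul_apply_eq_comp, P.op_inner, P.op_inner,
    P.op_anti hij, inner_neg_right]

/-- For a complex structure `blockJ A e f` on `M_+`, where `A` maps `e` and `f` to normal vectors,
no Hermitian metric is balanced. -/
theorem not_isBalanced_ofBlock (P : CliffordSystem m l) (hm : 0 < m) (hml : m < l) {r : ℕ}
    {A : E l →L[ℝ] E l} {e f : E l → Fin r → E l}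
    (he : ∀ i, ContDiff ℝ ∞ fun x => e x i) (hf : ∀ i, ContDiff ℝ ∞ fun x => f x i)
    (hB : ∀ x ∈ P.MPlus, IsBlock A (e x) (f x) (P.tangent x))
    (hl : 2 * l = 2 * (P.complexDim - 1) + 2 + (m + 2)) (hr : 2 * r < 2 * l - (m + 2))
    (hA : ∀ u v, ⟪A u, v⟫_ℝ = -⟪u, A v⟫_ℝ)
    (hAe : ∀ x ∈ P.MPlus, ∀ i, ∀ v ∈ P.tangent x, ⟪A (e x i), v⟫_ℝ = 0)
    (hAf : ∀ x ∈ P.MPlus, ∀ i, ∀ v ∈ P.tangent x, ⟪A (f x i), v⟫_ℝ = 0)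
    (h : HermitianMetric (P.ofBlock A e f he hf hB)) : ¬ h.IsBalanced := by
  refine not_isBalanced_of_semipositive h hl (P.MPlus_nonempty hm hml) hA (fun x w => ?_)
    fun x => ?_
  · exact (hB x x.2).inner_blockJ_nonneg (hAe x x.2) (hAf x x.2) w.2
  · obtain ⟨X, hX, hpos⟩ := (hB x x.2).exists_inner_blockJ_pos (by rwa [P.finrank_tangent x.2])
    exact ⟨⟨X, hX⟩, hpos⟩

/-- Here `A = P₀P₁` sends `P₀P₁x` to `-x` and `P₀P₁P₂x` to `-P₂x`, both normal. With `r = 1`, the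
bound `3 < l` is exactly `2r < dim M_+`. -/
theorem not_isBalanced_J2 (P : CliffordSystem 2 l) (hl : 3 < l) (h : HermitianMetric P.J2) :
    ¬ h.IsBalanced := by
  have a10 : ∀ y, P.op 1 (P.op 0 y) = -P.op 0 (P.op 1 y) := P.op_anti (by decide)
  refine P.not_isBalanced_ofBlock two_pos (by omega) _ _ _ (by unfold complexDim; omega) (by omega)
    (P.op_mul_op_skew (by decide)) (fun x _ => ?_) (fun x _ => ?_) h
  · intro i v hv
    obtain ⟨h1, h2⟩ := P.mem_tangent_iff.1 hv
    rw [real_inner_comm]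
    simp [a10, P.op_sq, h1]
  · intro i v hv
    obtain ⟨h1, h2⟩ := P.mem_tangent_iff.1 hv
    rw [real_inner_comm]
    simp [a10, P.op_sq, h2]

/-- Definiteness gives `P₀P₁ = ∓P₂P₃P₄`, so `A` sends `P₃P₄x`, `P₂P₄x`, `P₂P₃x` to multiples of
`P₂x`, `P₃x`, `P₄x`, and `P₀P₁x` to `-x`. With `r = 2`, the bound `5 < l` is exactly `2r < dim M_+`.
-/
theorem not_isBalanced_J3 (P : CliffordSystem 4 l) (hP : P.IsDefinite) (hl : 5 < l)
    (g : HermitianMetric (P.J3 hP)) : ¬ g.IsBalanced := by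
  obtain ⟨ε, hε⟩ : ∃ ε : ℝ, ∀ y, P.op 0 (P.op 1 (P.op 2 (P.op 3 (P.op 4 y)))) = ε • y := by
    rcases hP with h | h
    · exact ⟨1, fun y => by simpa using congrArg (fun T : E l →L[ℝ] E l => T y) h⟩
    · exact ⟨-1, fun y => by simpa using congrArg (fun T : E l →L[ℝ] E l => T y) h⟩
  have a10 : ∀ y, P.op 1 (P.op 0 y) = -P.op 0 (P.op 1 y) := P.op_anti (by decide)
  have a32 : ∀ y, P.op 3 (P.op 2 y) = -P.op 2 (P.op 3 y) := P.op_anti (by decide)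
  have a42 : ∀ y, P.op 4 (P.op 2 y) = -P.op 2 (P.op 4 y) := P.op_anti (by decide)
  have a43 : ∀ y, P.op 4 (P.op 3 y) = -P.op 3 (P.op 4 y) := P.op_anti (by decide)
  have d0 : ∀ y, P.op 0 (P.op 1 y) = -(ε • P.op 2 (P.op 3 (P.op 4 y))) := by
    intro y
    have := hε (P.op 4 (P.op 3 (P.op 2 y)))
    simp only [P.op_sq] at this
    rw [this]
    simp [a32, a42, a43]
  refine P.not_isBalanced_ofBlock (by norm_num) (by omega) _ _ _ (by unfold complexDim; omega)
    (by omega) (P.op_mul_op_skew (by decide)) (fun x _ => ?_) (fun x _ => ?_) g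
  · intro i v hv
    obtain ⟨h1, h2⟩ := P.mem_tangent_iff.1 hv
    rw [real_inner_comm]
    fin_cases i
    · simp [a10, P.op_sq, h1]
    · simp [d0, a32, a42, a43, P.op_sq, h2, inner_smul_right]
  · intro i v hv
    obtain ⟨h1, h2⟩ := P.mem_tangent_iff.1 hv
    rw [real_inner_comm]
    fin_cases i <;> simp [d0, a32, a42, a43, P.op_sq, h2, inner_smul_right]

end CliffordSystem

end OTFKM

theorem mainTheorem9 :
    (∀ (l : ℕ), 2 + 1 < l → ∀ P : OTFKM.CliffordSystem 2 l,
      ¬ ∃ h : OTFKM.CliffordSystem.HermitianMetric P.J2, h.IsBalanced) ∧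
    (∀ (l : ℕ), 4 + 1 < l → ∀ (P : OTFKM.CliffordSystem 4 l) (hP : P.IsDefinite),
      ¬ ∃ h : OTFKM.CliffordSystem.HermitianMetric (P.J3 hP), h.IsBalanced) :=
  ⟨fun _ hl P ⟨h, hb⟩ => P.not_isBalanced_J2 hl h hb,
    fun _ hl P hP ⟨h, hb⟩ => P.not_isBalanced_J3 hP hl h hb⟩
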